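/- Let $X, M$ be smooth manifolds, $G, H$ Lie groups (all finite-dimensional), $\pi\colon Q\to X$ a principal $H$-bundle with a connection $\varphi\in\Omega^1(Q;\mathfrak h)$ and curvature $\Phi$. Let $H$ act smoothly on $M$ from the left, let $P\to M$ be a principal $G$-bundle, and let a lift of the $H$-action to a smooth action on $P$ commuting with $G$ be given. Put $\mathbb M=Q\times_H M$ and $\mathbb P=Q\times_H P$, so that $\mathbb P\to\mathbb M$ is a principal $G$-bundle, and write $\tau\colon Q\times M\to\mathbb M$, $\tau\colon Q\times P\to\mathbb P$ for the projections. The connection $\varphi$ splits $T\mathbb M$ and $T\mathbb P$ into the horizontal subbundle $\tau_*(\ker\varphi)$ and the vertical subbundle (the tangent spaces of the fibres over $X$); bidegree $(p,q)$ means horizontal degree $p$ and vertical degree $q$. Let $a$ be a section of the bundle $\mathbb A=Q\times_H\mathcal A(P)$ of fibrewise connections, i.e. a smooth family $q\mapsto a_q$, $q\in Q$, of connections on $P$ with $a_{qh}=h^*a_q$. Let $b\in\Omega^1(X;\,Q\times_H\Omega^0(M;\mathrm{ad}\,P))$, i.e. a smooth horizontal $H$-equivariant 1-form $b$ on $Q$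 with values in the $G$-equivariant functions $P\to\mathfrak g$. Let $\hat a$ be the form on $\mathbb P$ which equals $a$ on vertical vectors and $0$ on horizontal vectors, and $\hat b$ the form which equals $b$ on horizontal vectors and $0$ on vertical vectors. Then the components of the curvature $F_A=dA+\frac12[A\wedge A]\in\Omega^2(\mathbb M;\mathrm{ad}\,\mathbb P)$ of a connection $A=\hat a+\hat b$ on $\mathbb P$ are $$F_A^{0,2}=F_a,\qquad F_A^{1,1}=\nabla^\varphi a+\nabla^a b,\qquad F_A^{2,0}=-\imath_\Phi a+d_\varphi b+[b,b].$$ Here forms on $X$ with values in $Q\times_H\Omega(M;\mathrm{ad}\,P)$ are identified with $\mathrm{ad}\,\mathbb P$-valued forms on $\mathbb M$, and the terms are as follows, at $q\in Q$, $p\in P$, for $u,v\in\ker\varphi_q$ and $w\in T_pP$. $F_a$ is the curvature of $a_q$. $(\nabla^\varphi a)(u,w)$ is the derivative of $q\mapsto a_q(w)$ in the direction $u$. The form $\nabla^a b$ is the vertical covariant differential of $b$, $(\nabla^a b)(w,u)=\nabla^{a}_w(b(u))=d(b(u))(w)+[a(w),b(u)]$; thus $F_A^{1,1}(\tau_*u,\tau_*w)=(\nabla^\varphi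 a)(u,w)-\nabla^a_w(b(u))$. Next, $(\imath_\Phi a)(u,v)=a(K_{\Phi(u,v)})$, where $K_\xi(p)=\frac{d}{dt}\big|_{0}\exp(-t\xi)p$ for $\xi\in\mathfrak h$; $d_\varphi b$ is the exterior derivative of $b$ on $Q$ evaluated on horizontal vectors; and $[b,b](u,v)=[b(u),b(v)]$. -/

import Mathlib

open scoped Manifold ContDiff
open MulOpposite

noncomputable section

/-! ### Principal bundles -/

section Principal

/-- A smooth local trivialization over an open set `base` of a map `proj : P → M` whose total
space carries a right action of `G`, given by the local section `sec` and the `G`-valued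
coordinate `coord`: the maps `(x, g) ↦ sec x · g` and `p ↦ (proj p, coord p)` are mutually
inverse smooth maps between `base × G` and `proj ⁻¹' base`. -/
structure LocalTriv (EM EG EP : Type*)
    [NormedAddCommGroup EM] [NormedSpace ℝ EM] [NormedAddCommGroup EG] [NormedSpace ℝ EG]
    [NormedAddCommGroup EP] [NormedSpace ℝ EP]
    {M G P : Type*} [TopologicalSpace M] [ChartedSpace EM M]
    [Group G] [TopologicalSpace G] [ChartedSpace EG G]
    [TopologicalSpace P] [ChartedSpace EP P] [MulAction Gᵐᵒᵖ P] (proj : P → M) where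
  base : Set M
  isOpen_base : IsOpen base
  sec : M → P
  coord : P → G
  smooth_sec : ContMDiffOn 𝓘(ℝ, EM) 𝓘(ℝ, EP) ∞ sec base
  smooth_coord : ContMDiffOn 𝓘(ℝ, EP) 𝓘(ℝ, EG) ∞ coord (proj ⁻¹' base)
  proj_sec : ∀ x ∈ base, proj (sec x) = x
  sec_act_coord : ∀ p, proj p ∈ base → op (coord p) • sec (proj p) = p
  coord_sec_act : ∀ x ∈ base, ∀ g : G, coord (op g • sec x) = g

/-- A smooth principal `G`-bundle `P → M`; the right action of `G` on `P` is the action of the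
opposite group, `p · g = op g • p`. -/
structure PrincipalBundle (EM EG EP : Type*)
    [NormedAddCommGroup EM] [NormedSpace ℝ EM] [NormedAddCommGroup EG] [NormedSpace ℝ EG]
    [NormedAddCommGroup EP] [NormedSpace ℝ EP]
    (M G P : Type*) [TopologicalSpace M] [ChartedSpace EM M]
    [Group G] [TopologicalSpace G] [ChartedSpace EG G]
    [TopologicalSpace P] [ChartedSpace EP P] [MulAction Gᵐᵒᵖ P] where
  proj : P → M
  smooth_proj : ContMDiff 𝓘(ℝ, EP) 𝓘(ℝ, EM) ∞ proj
  smooth_act : ContMDiff (𝓘(ℝ, EP).prod 𝓘(ℝ, EG)) 𝓘(ℝ, EP) ∞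
    (fun x : P × G => op x.2 • x.1)
  proj_act : ∀ (p : P) (g : G), proj (op g • p) = proj p
  exists_triv : ∀ x : M, ∃ t : LocalTriv EM EG EP (G := G) proj, x ∈ t.base

end Principal

/-! ### The associated bundle `Q ×_H F` as a smooth manifold -/

section Assoc

variable {EX EH EQ EF : Type*}
  [NormedAddCommGroup EX] [NormedSpace ℝ EX] [NormedAddCommGroup EH] [NormedSpace ℝ EH]
  [NormedAddCommGroup EQ] [NormedSpace ℝ EQ] [NormedAddCommGroup EF] [NormedSpace ℝ EF]
  {X H Q F : Type*} [TopologicalSpace X] [ChartedSpace EX X]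
  [Group H] [TopologicalSpace H] [ChartedSpace EH H]
  [TopologicalSpace Q] [ChartedSpace EQ Q] [MulAction Hᵐᵒᵖ Q]
  (𝔮 : PrincipalBundle EX EH EQ X H Q)

/-- The relation `(q · h, f) ∼ (q, h • f)` on `Q × F`. -/
def assocSetoid (_ : PrincipalBundle EX EH EQ X H Q) (F : Type*) [MulAction H F] :
    Setoid (Q × F) where
  r a b := ∃ h : H, op h • a.1 = b.1 ∧ a.2 = h • b.2
  iseqv :=
    { refl := fun a => ⟨1, by simp⟩
      symm := by
        rintro a b ⟨h, h1, h2⟩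
        refine ⟨h⁻¹, ?_, ?_⟩
        · rw [← h1, smul_smul, ← op_mul]; simp
        · rw [h2]; simp
      trans := by
        rintro a b c ⟨h, h1, h2⟩ ⟨k, k1, k2⟩
        refine ⟨h * k, ?_, ?_⟩
        · rw [op_mul, mul_smul, h1, k1]
        · rw [h2, k2, mul_smul] }

/-- The associated bundle `Q ×_H F`. -/
def Assoc (F : Type*) [MulAction H F] : Type _ := Quotient (assocSetoid 𝔮 F)

variable {𝔮} [MulAction H F]

namespace Assoc

instance [TopologicalSpace F] : TopologicalSpace (Assoc 𝔮 F) :=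
  inferInstanceAs (TopologicalSpace (Quotient (assocSetoid 𝔮 F)))

/-- The projection `τ : Q × F → Q ×_H F`. -/
def mk (q : Q) (f : F) : Assoc 𝔮 F := Quotient.mk (assocSetoid 𝔮 F) (q, f)

/-- A representative in `Q × F` of a point of `Q ×_H F`. -/
def rep (z : Assoc 𝔮 F) : Q × F := Quotient.out z

lemma mk_rep (z : Assoc 𝔮 F) : mk (rep z).1 (rep z).2 = z := Quotient.out_eq z

lemma mk_act (q : Q) (h : H) (f : F) : mk (𝔮 := 𝔮) (op h • q) f = mk q (h • f) :=
  (Quotient.sound (s := assocSetoid 𝔮 F) ⟨h, rfl, rfl⟩).symm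

lemma mk_eq_iff {q q' : Q} {f f' : F} :
    mk (𝔮 := 𝔮) q f = mk q' f' ↔ ∃ h : H, op h • q = q' ∧ f = h • f' :=
  Quotient.eq (r := assocSetoid 𝔮 F)

lemma ind {p : Assoc 𝔮 F → Prop} (h : ∀ q f, p (mk q f)) (z) : p z := by
  rw [← mk_rep z]; exact h _ _

/-- The bundle projection `ρ : Q ×_H F → X`. -/
def toBase (z : Assoc 𝔮 F) : X :=
  Quotient.lift (s := assocSetoid 𝔮 F) (fun a : Q × F => 𝔮.proj a.1)
    (by rintro a b ⟨h, h1, -⟩; simp [← h1, 𝔮.proj_act]) z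

@[simp] lemma toBase_mk (q : Q) (f : F) : toBase (mk (𝔮 := 𝔮) q f) = 𝔮.proj q := rfl

lemma isQuotientMap_mk [TopologicalSpace F] :
    Topology.IsQuotientMap (fun x : Q × F => mk (𝔮 := 𝔮) x.1 x.2) :=
  isQuotientMap_quot_mk

lemma continuous_toBase [TopologicalSpace F] : Continuous (toBase (𝔮 := 𝔮) (F := F)) :=
  isQuotientMap_mk.continuous_iff.2 (𝔮.smooth_proj.continuous.comp continuous_fst)

lemma coord_act (t : LocalTriv EX EH EQ (G := H) 𝔮.proj) (q : Q) (hq : 𝔮.proj q ∈ t.base)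
    (h : H) : t.coord (op h • q) = t.coord q * h := by
  conv_lhs => rw [← t.sec_act_coord q hq, smul_smul, ← op_mul]
  exact t.coord_sec_act _ hq _

/-- The fibre coordinate of `Q ×_H F` in a local trivialization of `Q`:
`[q, f] ↦ coord q • f`. -/
def fibreCoord (t : LocalTriv EX EH EQ (G := H) 𝔮.proj) (z : Assoc 𝔮 F) : F :=
  t.coord (rep z).1 • (rep z).2

lemma fibreCoord_mk (t : LocalTriv EX EH EQ (G := H) 𝔮.proj) (q : Q) (f : F)
    (hq : 𝔮.proj q ∈ t.base) : fibreCoord t (mk (𝔮 := 𝔮) q f) = t.coord q • f := by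
  obtain ⟨h, h1, h2⟩ := mk_eq_iff.1 (mk_rep (mk (𝔮 := 𝔮) q f))
  have : 𝔮.proj (rep (mk (𝔮 := 𝔮) q f)).1 ∈ t.base := by
    rw [← 𝔮.proj_act _ h, h1]; exact hq
  have h3 : t.coord q = t.coord (rep (mk (𝔮 := 𝔮) q f)).1 * h := by
    rw [← coord_act t _ this, h1]
  rw [h3, mul_smul, ← h2, fibreCoord]

lemma mk_sec_fibreCoord (t : LocalTriv EX EH EQ (G := H) 𝔮.proj) (z : Assoc 𝔮 F)
    (hz : toBase z ∈ t.base) : mk (t.sec (toBase z)) (fibreCoord t z) = z := by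
  induction z using ind with
  | h q f =>
    rw [fibreCoord_mk t q f hz, ← mk_act, toBase_mk, t.sec_act_coord q hz]

section Charts

variable [TopologicalSpace F] [ChartedSpace EF F] [ContMDiffSMul 𝓘(ℝ, EH) 𝓘(ℝ, EF) ∞ H F]

/-- The local trivialization `[q, f] ↦ (π q, coord q • f)` of `Q ×_H F`, with inverse
`(x, f) ↦ [sec x, f]`. -/
def triv (EF : Type*) [NormedAddCommGroup EF] [NormedSpace ℝ EF] [ChartedSpace EF F]
    [ContMDiffSMul 𝓘(ℝ, EH) 𝓘(ℝ, EF) ∞ H F]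
    (t : LocalTriv EX EH EQ (G := H) 𝔮.proj) : OpenPartialHomeomorph (Assoc 𝔮 F) (X × F) where
  toFun z := (toBase z, fibreCoord t z)
  invFun x := mk (t.sec x.1) x.2
  source := toBase ⁻¹' t.base
  target := t.base ×ˢ Set.univ
  map_source' z hz := ⟨hz, trivial⟩
  map_target' x hx := by simpa [t.proj_sec _ hx.1] using hx.1
  left_inv' z hz := mk_sec_fibreCoord t z hz
  right_inv' x hx := by
    have h1 := t.coord_sec_act x.1 hx.1 1
    rw [op_one, one_smul] at h1
    have h2 := t.proj_sec _ hx.1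
    ext
    · simpa using h2
    · simp only
      rw [fibreCoord_mk _ _ _ (by rw [h2]; exact hx.1), h1, one_smul]
  open_source := t.isOpen_base.preimage continuous_toBase
  open_target := t.isOpen_base.prod isOpen_univ
  continuousOn_toFun := by
    have : ContinuousSMul H F := ContMDiffSMul.continuousSMul (I := 𝓘(ℝ, EH)) (I' := 𝓘(ℝ, EF)) ∞
    refine (continuous_toBase (𝔮 := 𝔮) (F := F)).continuousOn.prodMk ?_
    refine (isQuotientMap_mk.continuousOn_isOpen_iff
      (t.isOpen_base.preimage continuous_toBase)).2 ?_
    have h1 : ContinuousOn (fun x : Q × F => t.coord x.1 • x.2)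
        ((fun x : Q × F => mk (𝔮 := 𝔮) x.1 x.2) ⁻¹' (toBase ⁻¹' t.base)) := by
      refine ContinuousOn.smul ?_ continuousOn_snd
      exact t.smooth_coord.continuousOn.comp continuousOn_fst (fun x hx => hx)
    exact h1.congr fun x hx => fibreCoord_mk t x.1 x.2 hx
  continuousOn_invFun := by
    have hm : Continuous (fun x : Q × F => mk (𝔮 := 𝔮) x.1 x.2) := isQuotientMap_mk.continuous
    have hs : ContinuousOn (fun x : X × F => (t.sec x.1, x.2)) (t.base ×ˢ Set.univ) :=
      (t.smooth_sec.continuousOn.comp continuousOn_fst (fun x hx => hx.1)).prodMk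
        continuousOn_snd
    exact hm.comp_continuousOn hs

/-- The local trivialization of `Q` chosen around `x`. -/
def trivAt (𝔮 : PrincipalBundle EX EH EQ X H Q) (x : X) :
    LocalTriv EX EH EQ (G := H) 𝔮.proj :=
  (𝔮.exists_triv x).choose

lemma mem_trivAt (x : X) : x ∈ (trivAt 𝔮 x).base := (𝔮.exists_triv x).choose_spec

/-- The smooth structure of `Q ×_H F`: its charts are the local trivializations followed by
charts of `X` and `F`. -/
instance : ChartedSpace (EX × EF) (Assoc 𝔮 F) where
  atlas := {e | ∃ (t : LocalTriv EX EH EQ (G := H) 𝔮.proj) (c : OpenPartialHomeomorph X EX)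
    (c' : OpenPartialHomeomorph F EF), c ∈ atlas EX X ∧ c' ∈ atlas EF F ∧
    e = (triv EF t).trans (c.prod c')}
  chartAt z := (triv EF (trivAt 𝔮 (toBase z))).trans
    ((chartAt EX (toBase z)).prod (chartAt EF (fibreCoord (trivAt 𝔮 (toBase z)) z)))
  mem_chart_source z := by
    refine ⟨mem_trivAt (toBase z), ?_, ?_⟩
    · exact mem_chart_source EX (toBase z)
    · exact mem_chart_source EF (fibreCoord (trivAt 𝔮 (toBase z)) z)
  chart_mem_atlas z := ⟨_, _, _, chart_mem_atlas _ _, chart_mem_atlas _ _, rfl⟩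

section Smooth

variable [IsManifold 𝓘(ℝ, EX) ∞ X] [IsManifold 𝓘(ℝ, EF) ∞ F]

lemma contMDiffOn_chart {E N : Type*} [NormedAddCommGroup E] [NormedSpace ℝ E]
    [TopologicalSpace N] [ChartedSpace E N] [IsManifold 𝓘(ℝ, E) ∞ N]
    {c : OpenPartialHomeomorph N E} (hc : c ∈ atlas E N) :
    ContMDiffOn 𝓘(ℝ, E) 𝓘(ℝ, E) ∞ c c.source :=
  contMDiffOn_of_mem_maximalAtlas (IsManifold.subset_maximalAtlas hc)

lemma contMDiffOn_chart_symm {E N : Type*} [NormedAddCommGroup E] [NormedSpace ℝ E]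
    [TopologicalSpace N] [ChartedSpace E N] [IsManifold 𝓘(ℝ, E) ∞ N]
    {c : OpenPartialHomeomorph N E} (hc : c ∈ atlas E N) :
    ContMDiffOn 𝓘(ℝ, E) 𝓘(ℝ, E) ∞ c.symm c.target :=
  contMDiffOn_symm_of_mem_maximalAtlas (IsManifold.subset_maximalAtlas hc)

instance : IsManifold 𝓘(ℝ, EX × EF) ∞ (Assoc 𝔮 F) := by
  apply isManifold_of_contDiffOn
  rintro e e' ⟨t, c, d, hc, hd, rfl⟩ ⟨t', c', d', hc', hd', rfl⟩
  simp only [modelWithCornersSelf_coe, modelWithCornersSelf_coe_symm, Function.comp_id,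
    Function.id_comp, Set.preimage_id_eq, id_eq, Set.range_id, Set.inter_univ]
  rw [← contMDiffOn_iff_contDiffOn]
  set s := (((triv EF t).trans (c.prod d)).symm.trans ((triv EF t').trans (c'.prod d'))).source
  have hs : ∀ y ∈ s, y.1 ∈ c.target ∧ y.2 ∈ d.target ∧ c.symm y.1 ∈ t.base ∧
      𝔮.proj (t.sec (c.symm y.1)) ∈ t'.base ∧ c.symm y.1 ∈ c'.source ∧
      t'.coord (t.sec (c.symm y.1)) • d.symm y.2 ∈ d'.source := by
    intro y hy
    simp only [s, OpenPartialHomeomorph.trans_source, OpenPartialHomeomorph.symm_source,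
      OpenPartialHomeomorph.trans_target] at hy
    obtain ⟨⟨h1, h2⟩, h3, h4⟩ := hy
    have h1' : y.1 ∈ c.target ∧ y.2 ∈ d.target := h1
    have h2' : c.symm y.1 ∈ t.base := h2.1
    have h3' : 𝔮.proj (t.sec (c.symm y.1)) ∈ t'.base := h3
    have h4' : 𝔮.proj (t.sec (c.symm y.1)) ∈ c'.source ∧
      fibreCoord t' (mk (t.sec (c.symm y.1)) (d.symm y.2)) ∈ d'.source := h4
    rw [fibreCoord_mk _ _ _ h3', t.proj_sec _ h2'] at h4'
    exact ⟨h1'.1, h1'.2, h2', h3', h4'.1, h4'.2⟩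
  have hsec : ContMDiffOn 𝓘(ℝ, EX × EF) 𝓘(ℝ, EX) ∞ (fun y : EX × EF => c.symm y.1) s :=
    (contMDiffOn_chart_symm hc).comp contDiff_fst.contMDiff.contMDiffOn fun y hy => (hs y hy).1
  have hd1 : ContMDiffOn 𝓘(ℝ, EX × EF) 𝓘(ℝ, EF) ∞ (fun y : EX × EF => d.symm y.2) s :=
    (contMDiffOn_chart_symm hd).comp contDiff_snd.contMDiff.contMDiffOn fun y hy => (hs y hy).2.1
  have h1 : ContMDiffOn 𝓘(ℝ, EX × EF) 𝓘(ℝ, EX) ∞ (fun y : EX × EF => c' (c.symm y.1)) s :=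
    (contMDiffOn_chart hc').comp hsec fun y hy => (hs y hy).2.2.2.2.1
  have h2 : ContMDiffOn 𝓘(ℝ, EX × EF) 𝓘(ℝ, EH) ∞
      (fun y : EX × EF => t'.coord (t.sec (c.symm y.1))) s :=
    t'.smooth_coord.comp (t.smooth_sec.comp hsec fun y hy => (hs y hy).2.2.1)
      fun y hy => (hs y hy).2.2.2.1
  have h3 : ContMDiffOn 𝓘(ℝ, EX × EF) 𝓘(ℝ, EF) ∞
      (fun y : EX × EF => d' (t'.coord (t.sec (c.symm y.1)) • d.symm y.2)) s :=
    (contMDiffOn_chart hd').comp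
      ((contMDiff_smul (I := 𝓘(ℝ, EH)) (I' := 𝓘(ℝ, EF)) (n := ∞) (G := H) (M := F)).comp_contMDiffOn
        (h2.prodMk hd1)) fun y hy => (hs y hy).2.2.2.2.2
  refine (h1.prodMk_space h3).congr fun y hy => ?_
  obtain ⟨-, -, a, b, -, -⟩ := hs y hy
  have e1 : (((triv EF t).trans (c.prod d)).symm.trans ((triv EF t').trans (c'.prod d'))) y =
    (c' (𝔮.proj (t.sec (c.symm y.1))),
      d' (fibreCoord t' (mk (t.sec (c.symm y.1)) (d.symm y.2)))) := rfl
  rw [e1, fibreCoord_mk _ _ _ b, t.proj_sec _ a]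

lemma contMDiffOn_triv (t : LocalTriv EX EH EQ (G := H) 𝔮.proj) :
    ContMDiffOn 𝓘(ℝ, EX × EF) 𝓘(ℝ, EX) ∞ (toBase (𝔮 := 𝔮) (F := F)) (toBase ⁻¹' t.base) ∧
    ContMDiffOn 𝓘(ℝ, EX × EF) 𝓘(ℝ, EF) ∞ (fibreCoord (𝔮 := 𝔮) (F := F) t)
      (toBase ⁻¹' t.base) := by
  have key : ∀ z : Assoc 𝔮 F, toBase z ∈ t.base →
      ContMDiffAt 𝓘(ℝ, EX × EF) 𝓘(ℝ, EX) ∞ (toBase (𝔮 := 𝔮) (F := F)) z ∧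
      ContMDiffAt 𝓘(ℝ, EX × EF) 𝓘(ℝ, EF) ∞ (fibreCoord (𝔮 := 𝔮) (F := F) t) z := by
    intro z hz
    set c := chartAt EX (toBase z)
    set d := chartAt EF (fibreCoord t z)
    set e : OpenPartialHomeomorph (Assoc 𝔮 F) (EX × EF) := (triv EF t).trans (c.prod d)
    have he : e ∈ atlas (EX × EF) (Assoc 𝔮 F) :=
      ⟨t, c, d, chart_mem_atlas _ _, chart_mem_atlas _ _, rfl⟩
    have hze : z ∈ e.source := ⟨hz, mem_chart_source EX _, mem_chart_source EF _⟩
    have hsrc : ∀ w ∈ e.source, toBase w ∈ c.source ∧ fibreCoord t w ∈ d.source :=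
      fun w hw => hw.2
    have h1 : ContMDiffAt 𝓘(ℝ, EX × EF) 𝓘(ℝ, EX × EF) ∞ e z :=
      (contMDiffOn_chart he).contMDiffAt (e.open_source.mem_nhds hze)
    have hc : ContMDiffAt 𝓘(ℝ, EX) 𝓘(ℝ, EX) ∞ c.symm (e z).1 :=
      (contMDiffOn_chart_symm (chart_mem_atlas EX _)).contMDiffAt
        (c.open_target.mem_nhds (c.map_source (hsrc z hze).1))
    have hd : ContMDiffAt 𝓘(ℝ, EF) 𝓘(ℝ, EF) ∞ d.symm (e z).2 :=
      (contMDiffOn_chart_symm (chart_mem_atlas EF _)).contMDiffAt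
        (d.open_target.mem_nhds (d.map_source (hsrc z hze).2))
    have hev : ∀ᶠ w in nhds z, w ∈ e.source := e.open_source.mem_nhds hze
    constructor
    · refine (hc.comp z (contDiff_fst.contMDiff.contMDiffAt.comp z h1)).congr_of_eventuallyEq ?_
      filter_upwards [hev] with w hw
      exact (c.left_inv (hsrc w hw).1).symm
    · refine (hd.comp z (contDiff_snd.contMDiff.contMDiffAt.comp z h1)).congr_of_eventuallyEq ?_
      filter_upwards [hev] with w hw
      exact (d.left_inv (hsrc w hw).2).symm
  exact ⟨fun z hz => (key z hz).1.contMDiffWithinAt, fun z hz => (key z hz).2.contMDiffWithinAt⟩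

lemma contMDiff_toBase : ContMDiff 𝓘(ℝ, EX × EF) 𝓘(ℝ, EX) ∞ (toBase (𝔮 := 𝔮) (F := F)) :=
  fun z => (contMDiffOn_triv (trivAt 𝔮 (toBase z))).1.contMDiffAt
    (((trivAt 𝔮 (toBase z)).isOpen_base.preimage continuous_toBase).mem_nhds
      (mem_trivAt (toBase z)))

lemma contMDiff_mk : ContMDiff (𝓘(ℝ, EQ).prod 𝓘(ℝ, EF)) 𝓘(ℝ, EX × EF) ∞
    (fun x : Q × F => mk (𝔮 := 𝔮) x.1 x.2) := by
  rintro ⟨q, f⟩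
  set t := trivAt 𝔮 (𝔮.proj q)
  have ht : 𝔮.proj q ∈ t.base := mem_trivAt _
  set c := chartAt EX (𝔮.proj q)
  set d := chartAt EF (t.coord q • f)
  set e : OpenPartialHomeomorph (Assoc 𝔮 F) (EX × EF) := (triv EF t).trans (c.prod d)
  have he : e ∈ atlas (EX × EF) (Assoc 𝔮 F) :=
    ⟨t, c, d, chart_mem_atlas _ _, chart_mem_atlas _ _, rfl⟩
  have hze : mk q f ∈ e.source := by
    refine ⟨ht, mem_chart_source EX _, ?_⟩
    change fibreCoord t (mk q f) ∈ d.source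
    rw [fibreCoord_mk t q f ht]
    exact mem_chart_source EF _
  have hproj : ContMDiffAt (𝓘(ℝ, EQ).prod 𝓘(ℝ, EF)) 𝓘(ℝ, EX) ∞
      (fun x : Q × F => 𝔮.proj x.1) (q, f) :=
    (𝔮.smooth_proj.comp contMDiff_fst).contMDiffAt
  have hcoord : ContMDiffAt (𝓘(ℝ, EQ).prod 𝓘(ℝ, EF)) 𝓘(ℝ, EF) ∞
      (fun x : Q × F => t.coord x.1 • x.2) (q, f) := by
    have h0 : ContMDiffAt 𝓘(ℝ, EQ) 𝓘(ℝ, EH) ∞ t.coord q :=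
      t.smooth_coord.contMDiffAt
        ((t.isOpen_base.preimage 𝔮.smooth_proj.continuous).mem_nhds ht)
    have h1 : ContMDiffAt (𝓘(ℝ, EQ).prod 𝓘(ℝ, EF)) 𝓘(ℝ, EH) ∞
        (fun x : Q × F => t.coord x.1) (q, f) :=
      ContMDiffAt.comp (q, f) (g := t.coord) (f := Prod.fst) h0 contMDiffAt_fst
    exact (contMDiff_smul (I := 𝓘(ℝ, EH)) (I' := 𝓘(ℝ, EF)) (n := ∞) (G := H) (M := F)
      ).contMDiffAt.comp (q, f) (h1.prodMk contMDiffAt_snd)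
  have hc : ContMDiffAt 𝓘(ℝ, EX) 𝓘(ℝ, EX) ∞ c (𝔮.proj q) :=
    (contMDiffOn_chart (chart_mem_atlas EX _)).contMDiffAt
      (c.open_source.mem_nhds (mem_chart_source EX _))
  have hd : ContMDiffAt 𝓘(ℝ, EF) 𝓘(ℝ, EF) ∞ d (t.coord q • f) :=
    (contMDiffOn_chart (chart_mem_atlas EF _)).contMDiffAt
      (d.open_source.mem_nhds (mem_chart_source EF _))
  have h2 : ContMDiffAt (𝓘(ℝ, EQ).prod 𝓘(ℝ, EF)) 𝓘(ℝ, EX × EF) ∞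
      (fun x : Q × F => (c (𝔮.proj x.1), d (t.coord x.1 • x.2))) (q, f) :=
    (ContMDiffAt.comp (q, f) (g := c) hc hproj).prodMk_space
      (ContMDiffAt.comp (q, f) (g := d) hd hcoord)
  have h3 : e (mk q f) = (c (𝔮.proj q), d (t.coord q • f)) := by
    change (c (𝔮.proj q), d (fibreCoord t (mk q f))) = _
    rw [fibreCoord_mk t q f ht]
  have he' : ContMDiffAt 𝓘(ℝ, EX × EF) 𝓘(ℝ, EX × EF) ∞ e.symm
      (c (𝔮.proj q), d (t.coord q • f)) := by
    rw [← h3]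
    exact (contMDiffOn_chart_symm he).contMDiffAt (e.open_target.mem_nhds (e.map_source hze))
  refine (ContMDiffAt.comp (q, f) (g := e.symm) he' h2).congr_of_eventuallyEq ?_
  have hcont : Continuous (fun x : Q × F => mk (𝔮 := 𝔮) x.1 x.2) := isQuotientMap_mk.continuous
  filter_upwards [hcont.continuousAt.preimage_mem_nhds (e.open_source.mem_nhds hze)] with x hx
  have hx' : 𝔮.proj x.1 ∈ t.base := hx.1
  have h4 : e (mk x.1 x.2) = (c (𝔮.proj x.1), d (t.coord x.1 • x.2)) := by
    change (c (𝔮.proj x.1), d (fibreCoord t (mk x.1 x.2))) = _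
    rw [fibreCoord_mk t _ _ hx']
  change mk x.1 x.2 = e.symm (c (𝔮.proj x.1), d (t.coord x.1 • x.2))
  rw [← h4]
  exact (e.left_inv hx).symm

end Smooth

end Charts
/-- An action on `F` that commutes with the action of `H` acts on `Q ×_H F` by
`k • [q, f] = [q, k • f]`. -/
instance {K : Type*} [Monoid K] [MulAction K F] [SMulCommClass H K F] :
    MulAction K (Assoc 𝔮 F) where
  smul k := Quotient.map (sa := assocSetoid 𝔮 F) (sb := assocSetoid 𝔮 F)
    (fun a : Q × F => (a.1, k • a.2)) (by
      rintro a b ⟨h, h1, h2⟩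
      exact ⟨h, h1, by simp [h2, smul_comm h k]⟩)
  one_smul := ind fun q f => by
    change mk q ((1 : K) • f) = _
    rw [one_smul]
  mul_smul k l := ind fun q f => by
    change mk q ((k * l) • f) = mk q (k • l • f)
    rw [mul_smul]

@[simp] lemma smul_mk {K : Type*} [Monoid K] [MulAction K F] [SMulCommClass H K F] (k : K)
    (q : Q) (f : F) : k • mk (𝔮 := 𝔮) q f = mk q (k • f) := rfl

/-- The map `[q, f] ↦ [q, u f]` induced by an `H`-equivariant map `u`. -/
def map {F' : Type*} [MulAction H F'] (u : F → F') (hu : ∀ (h : H) f, u (h • f) = h • u f) :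
    Assoc 𝔮 F → Assoc 𝔮 F' :=
  Quotient.map (sa := assocSetoid 𝔮 F) (sb := assocSetoid 𝔮 F') (fun a => (a.1, u a.2)) (by
    rintro a b ⟨h, h1, h2⟩
    exact ⟨h, h1, by simp [h2, hu]⟩)

@[simp] lemma map_mk {F' : Type*} [MulAction H F'] (u : F → F')
    (hu : ∀ (h : H) f, u (h • f) = h • u f) (q : Q) (f : F) :
    map (𝔮 := 𝔮) u hu (mk q f) = mk q (u f) := rfl

section Induced

variable {EM EG EP : Type*}
  [NormedAddCommGroup EM] [NormedSpace ℝ EM] [NormedAddCommGroup EG] [NormedSpace ℝ EG]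
  [NormedAddCommGroup EP] [NormedSpace ℝ EP]
  {M G P : Type*} [TopologicalSpace M] [ChartedSpace EM M] [IsManifold 𝓘(ℝ, EM) ∞ M]
  [Group G] [TopologicalSpace G] [ChartedSpace EG G]
  [TopologicalSpace P] [ChartedSpace EP P] [IsManifold 𝓘(ℝ, EP) ∞ P] [MulAction Gᵐᵒᵖ P]
  [IsManifold 𝓘(ℝ, EX) ∞ X]
  [MulAction H M] [ContMDiffSMul 𝓘(ℝ, EH) 𝓘(ℝ, EM) ∞ H M]
  [MulAction H P] [ContMDiffSMul 𝓘(ℝ, EH) 𝓘(ℝ, EP) ∞ H P] [SMulCommClass H Gᵐᵒᵖ P]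

/-- `ℙ = Q ×_H P` as a principal `G`-bundle over `𝕄 = Q ×_H M`. -/
def principal (𝔮 : PrincipalBundle EX EH EQ X H Q) (𝔭 : PrincipalBundle EM EG EP M G P)
    (hlift : ∀ (h : H) (p : P), 𝔭.proj (h • p) = h • 𝔭.proj p) :
    PrincipalBundle (EX × EM) EG (EX × EP) (Assoc 𝔮 M) G (Assoc 𝔮 P) where
  proj := map 𝔭.proj hlift
  smooth_proj := by
    intro z
    set t := trivAt 𝔮 (toBase z)
    have hz : toBase z ∈ t.base := mem_trivAt _
    have hnhds : toBase ⁻¹' t.base ∈ nhds z :=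
      (t.isOpen_base.preimage continuous_toBase).mem_nhds hz
    obtain ⟨h1, h2⟩ := contMDiffOn_triv (𝔮 := 𝔮) (F := P) (EF := EP) t
    have h3 := t.smooth_sec.comp h1 fun w hw => hw
    have h4 := 𝔭.smooth_proj.comp_contMDiffOn h2
    have h5 := (contMDiff_mk (𝔮 := 𝔮) (F := M) (EF := EM)).comp_contMDiffOn (h3.prodMk h4)
    refine (h5.contMDiffAt hnhds).congr_of_eventuallyEq ?_
    filter_upwards [hnhds] with w hw
    conv_lhs => rw [← mk_sec_fibreCoord t w hw]
    rfl
  smooth_act := by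
    rintro ⟨z, g⟩
    set t := trivAt 𝔮 (toBase z)
    have hz : toBase z ∈ t.base := mem_trivAt _
    have hnhds : (fun x : Assoc 𝔮 P × G => toBase x.1) ⁻¹' t.base ∈ nhds (z, g) :=
      (t.isOpen_base.preimage (continuous_toBase.comp continuous_fst)).mem_nhds hz
    obtain ⟨h1, h2⟩ := contMDiffOn_triv (𝔮 := 𝔮) (F := P) (EF := EP) t
    have h3 : ContMDiffOn (𝓘(ℝ, EX × EP).prod 𝓘(ℝ, EG)) 𝓘(ℝ, EQ) ∞
        (fun x : Assoc 𝔮 P × G => t.sec (toBase x.1))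
        ((fun x : Assoc 𝔮 P × G => toBase x.1) ⁻¹' t.base) :=
      t.smooth_sec.comp (h1.comp contMDiffOn_fst fun w hw => hw) fun w hw => hw
    have h4 : ContMDiffOn (𝓘(ℝ, EX × EP).prod 𝓘(ℝ, EG)) 𝓘(ℝ, EP) ∞
        (fun x : Assoc 𝔮 P × G => op x.2 • fibreCoord t x.1)
        ((fun x : Assoc 𝔮 P × G => toBase x.1) ⁻¹' t.base) :=
      𝔭.smooth_act.comp_contMDiffOn
        ((h2.comp contMDiffOn_fst fun w hw => hw).prodMk contMDiffOn_snd)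
    have h5 := (contMDiff_mk (𝔮 := 𝔮) (F := P) (EF := EP)).comp_contMDiffOn (h3.prodMk h4)
    refine (h5.contMDiffAt hnhds).congr_of_eventuallyEq ?_
    filter_upwards [hnhds] with w hw
    conv_lhs => rw [← mk_sec_fibreCoord t w.1 hw]
    rfl
  proj_act := by
    intro z g
    induction z using ind with
    | h q p => simp [𝔭.proj_act]
  exists_triv y := by
    set t := trivAt 𝔮 (toBase y)
    have hy : toBase y ∈ t.base := mem_trivAt _
    obtain ⟨t', ht'⟩ := 𝔭.exists_triv (fibreCoord t y)
    obtain ⟨h1, h2⟩ := contMDiffOn_triv (𝔮 := 𝔮) (F := M) (EF := EM) t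
    obtain ⟨h1', h2'⟩ := contMDiffOn_triv (𝔮 := 𝔮) (F := P) (EF := EP) t
    have hfc : ∀ z : Assoc 𝔮 P, toBase z ∈ t.base →
        fibreCoord t (map 𝔭.proj hlift z) = 𝔭.proj (fibreCoord t z) := by
      intro z hz
      induction z using ind with
      | h q p => rw [map_mk, fibreCoord_mk _ _ _ hz, fibreCoord_mk _ _ _ hz, hlift]
    have hbase : ∀ z : Assoc 𝔮 P, toBase (map 𝔭.proj hlift z) = toBase z := by
      intro z
      induction z using ind with
      | h q p => rfl
    have hsec : ∀ x ∈ t.base, 𝔮.proj (t.sec x) ∈ t.base := by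
      intro x hx
      rw [t.proj_sec x hx]
      exact hx
    have hsec1 : ∀ x ∈ t.base, t.coord (t.sec x) = 1 := by
      intro x hx
      have := t.coord_sec_act x hx 1
      rwa [op_one, one_smul] at this
    refine ⟨{
      base := {w | toBase w ∈ t.base ∧ fibreCoord t w ∈ t'.base}
      isOpen_base := h2.continuousOn.isOpen_inter_preimage
        (t.isOpen_base.preimage continuous_toBase) t'.isOpen_base
      sec := fun w => mk (t.sec (toBase w)) (t'.sec (fibreCoord t w))
      coord := fun z => t'.coord (fibreCoord t z)
      smooth_sec := ?_
      smooth_coord := ?_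
      proj_sec := ?_
      sec_act_coord := ?_
      coord_sec_act := ?_ }, hy, ht'⟩
    · exact (contMDiff_mk (𝔮 := 𝔮) (F := P) (EF := EP)).comp_contMDiffOn
        ((t.smooth_sec.comp (h1.mono fun w hw => hw.1) fun w hw => hw.1).prodMk
          (t'.smooth_sec.comp (h2.mono fun w hw => hw.1) fun w hw => hw.2))
    · refine t'.smooth_coord.comp (h2'.mono fun z hz => ?_) fun z hz => ?_
      · have hz1 : toBase (map 𝔭.proj hlift z) ∈ t.base := hz.1
        rw [hbase] at hz1
        exact hz1
      · have := hz.2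
        rwa [hfc z ((hbase z) ▸ hz.1)] at this
    · intro w hw
      rw [map_mk, t'.proj_sec _ hw.2, mk_sec_fibreCoord t w hw.1]
    · intro z hz
      have hz1 : toBase z ∈ t.base := (hbase z) ▸ hz.1
      have hz2 : 𝔭.proj (fibreCoord t z) ∈ t'.base := by
        have := hz.2
        rwa [hfc z hz1] at this
      rw [hbase, hfc z hz1, smul_mk, t'.sec_act_coord _ hz2, mk_sec_fibreCoord t z hz1]
    · intro w hw g
      rw [smul_mk, fibreCoord_mk _ _ _ (hsec _ hw.1), hsec1 _ hw.1, one_smul,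
        t'.coord_sec_act _ hw.2]

end Induced

end Assoc
end Assoc

/-! ### Connections and curvature -/

section Forms

variable {EP EG : Type*} [NormedAddCommGroup EP] [NormedSpace ℝ EP]
  [NormedAddCommGroup EG] [NormedSpace ℝ EG]
  {P G : Type*} [TopologicalSpace P] [ChartedSpace EP P]
  [Group G] [TopologicalSpace G] [ChartedSpace EG G]

/-- `V`-valued 1-forms on the manifold `P`. -/
abbrev OneForm (EP P V : Type*) [NormedAddCommGroup EP] [NormedSpace ℝ EP]
    [NormedAddCommGroup V] [NormedSpace ℝ V] [TopologicalSpace P] [ChartedSpace EP P] : Type _ :=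
  (p : P) → TangentSpace 𝓘(ℝ, EP) p →L[ℝ] V

/-- `V`-valued 2-forms on the manifold `P`, as functions of two tangent vectors. -/
abbrev TwoForm (EP P V : Type*) [NormedAddCommGroup EP] [NormedSpace ℝ EP]
    [TopologicalSpace P] [ChartedSpace EP P] : Type _ :=
  (p : P) → TangentSpace 𝓘(ℝ, EP) p → TangentSpace 𝓘(ℝ, EP) p → V

/-- The 1-form `α` read in the chart at `p₀`, i.e. its pullback by the inverse of the chart. -/
def chartRep {V : Type*} [NormedAddCommGroup V] [NormedSpace ℝ V] (α : OneForm EP P V) (p₀ : P)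
    (y : EP) : EP →L[ℝ] V :=
  (α ((extChartAt 𝓘(ℝ, EP) p₀).symm y)).comp
    (mfderiv 𝓘(ℝ, EP) 𝓘(ℝ, EP) (extChartAt 𝓘(ℝ, EP) p₀).symm y)

/-- Smoothness of a 1-form: its local expressions in charts are smooth. -/
def SmoothOneForm {V : Type*} [NormedAddCommGroup V] [NormedSpace ℝ V] (α : OneForm EP P V) :
    Prop :=
  ∀ p₀ : P, ContDiffOn ℝ ∞ (chartRep α p₀) (extChartAt 𝓘(ℝ, EP) p₀).target

/-- The exterior derivative of a 1-form,
`dα (u, v) = u (α v) - v (α u) - α [u, v]`, computed in the chart at `p`; the tangent space at `p`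
is identified with the model space `EP` by this chart. -/
def extDerivOne {V : Type*} [NormedAddCommGroup V] [NormedSpace ℝ V] (α : OneForm EP P V) :
    TwoForm EP P V := fun p u v =>
  (fderiv ℝ (chartRep α p) (extChartAt 𝓘(ℝ, EP) p p) : EP →L[ℝ] EP →L[ℝ] V) u v -
    (fderiv ℝ (chartRep α p) (extChartAt 𝓘(ℝ, EP) p p) : EP →L[ℝ] EP →L[ℝ] V) v u

/-- The Lie bracket of the Lie algebra `T₁G` of `G`, whose underlying vector space is the model
space `EG` of `G`. -/
def lieBr (G : Type*) [Group G] [TopologicalSpace G] [ChartedSpace EG G] (ξ η : EG) : EG :=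
  let ξ' : GroupLieAlgebra 𝓘(ℝ, EG) G := ξ
  let η' : GroupLieAlgebra 𝓘(ℝ, EG) G := η
  (⁅ξ', η'⁆ : GroupLieAlgebra 𝓘(ℝ, EG) G)

/-- The adjoint action of `G` on its Lie algebra. -/
def adj (g : G) : EG →L[ℝ] EG :=
  mfderiv 𝓘(ℝ, EG) 𝓘(ℝ, EG) (fun x : G => g * x * g⁻¹) 1

/-- The fundamental vector field `d/dt (p · exp (t ξ))` at `t = 0` of a right action of `G`. -/
def fundRight [MulAction Gᵐᵒᵖ P] (p : P) (ξ : EG) : TangentSpace 𝓘(ℝ, EP) p :=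
  (mfderiv 𝓘(ℝ, EG) 𝓘(ℝ, EP) (fun g : G => op g • p) 1 : EG →L[ℝ] EP) ξ

/-- The Killing vector field `K_ξ = d/dt (exp (- t ξ) • p)` at `t = 0` of a left action of `G`. -/
def killing (G : Type*) [Group G] [TopologicalSpace G] [ChartedSpace EG G] [MulAction G P]
    (p : P) (ξ : EG) : TangentSpace 𝓘(ℝ, EP) p :=
  - (mfderiv 𝓘(ℝ, EG) 𝓘(ℝ, EP) (fun g : G => g • p) 1 : EG →L[ℝ] EP) ξ

end Forms

section Connections

variable {EM EG EP : Type*}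
  [NormedAddCommGroup EM] [NormedSpace ℝ EM] [NormedAddCommGroup EG] [NormedSpace ℝ EG]
  [NormedAddCommGroup EP] [NormedSpace ℝ EP]
  {M G P : Type*} [TopologicalSpace M] [ChartedSpace EM M]
  [Group G] [TopologicalSpace G] [ChartedSpace EG G]
  [TopologicalSpace P] [ChartedSpace EP P] [MulAction Gᵐᵒᵖ P]

/-- A (smooth) connection on a principal bundle, given by its connection form. -/
structure Connection (𝔭 : PrincipalBundle EM EG EP M G P) where
  form : OneForm EP P EG
  smooth : SmoothOneForm form
  form_fund : ∀ (p : P) (ξ : EG), form p (fundRight (G := G) p ξ) = ξ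
  form_act : ∀ (g : G) (p : P) (w : TangentSpace 𝓘(ℝ, EP) p),
    form (op g • p) (mfderiv 𝓘(ℝ, EP) 𝓘(ℝ, EP) (fun p' : P => op g • p') p w) =
      adj g⁻¹ (form p w)

/-- The curvature `F_A = dA + 1/2 [A ∧ A]`, i.e. `F_A (u, v) = dA (u, v) + [A u, A v]`.
A 2-form on the base with values in the adjoint bundle is represented, as usual, by the
corresponding horizontal equivariant Lie algebra valued 2-form on the total space. -/
def Connection.curvature {𝔭 : PrincipalBundle EM EG EP M G P} (A : Connection 𝔭) :
    TwoForm EP P EG := fun p u v =>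
  extDerivOne A.form p u v + lieBr G (A.form p u) (A.form p v)

/-- The horizontal part of a tangent vector of the total space. -/
def Connection.hor {𝔭 : PrincipalBundle EM EG EP M G P} (A : Connection 𝔭) (p : P)
    (u : TangentSpace 𝓘(ℝ, EP) p) : TangentSpace 𝓘(ℝ, EP) p :=
  u - fundRight (G := G) p (A.form p u)

end Connections

/-! ### The splitting of the tangent bundle of an associated bundle -/

section Splitting

variable {EX EH EQ EF : Type*}
  [NormedAddCommGroup EX] [NormedSpace ℝ EX] [NormedAddCommGroup EH] [NormedSpace ℝ EH]
  [NormedAddCommGroup EQ] [NormedSpace ℝ EQ] [NormedAddCommGroup EF] [NormedSpace ℝ EF]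
  {X H Q F : Type*} [TopologicalSpace X] [ChartedSpace EX X]
  [Group H] [TopologicalSpace H] [ChartedSpace EH H]
  [TopologicalSpace Q] [ChartedSpace EQ Q] [MulAction Hᵐᵒᵖ Q]
  {𝔮 : PrincipalBundle EX EH EQ X H Q} (φ : Connection 𝔮)
  [TopologicalSpace F] [ChartedSpace EF F] [MulAction H F]
  [ContMDiffSMul 𝓘(ℝ, EH) 𝓘(ℝ, EF) ∞ H F]

/-- The differential `τ_* (u, v)` of the projection `τ : Q × F → Q ×_H F` at `(q, f)`. -/
def tauD (𝔮 : PrincipalBundle EX EH EQ X H Q) (q : Q) (f : F) (u : TangentSpace 𝓘(ℝ, EQ) q)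
    (v : TangentSpace 𝓘(ℝ, EF) f) : TangentSpace 𝓘(ℝ, EX × EF) (Assoc.mk (𝔮 := 𝔮) q f) :=
  (mfderiv 𝓘(ℝ, EQ) 𝓘(ℝ, EX × EF) (fun q' => Assoc.mk (𝔮 := 𝔮) q' f) q : EQ →L[ℝ] EX × EF) u +
    (mfderiv 𝓘(ℝ, EF) 𝓘(ℝ, EX × EF) (fun f' => Assoc.mk (𝔮 := 𝔮) q f') f : EF →L[ℝ] EX × EF) v

/-- A tangent vector `w` of `Q ×_H F` at `z = [q, f]` is `τ_* (u, v)` for a unique pair of a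
`φ`-horizontal vector `u` at `q` and a vector `v` at `f`; this is that pair, for the chosen
representative `(q, f)` of `z`. -/
def splitVec (z : Assoc 𝔮 F) (w : TangentSpace 𝓘(ℝ, EX × EF) z) :
    TangentSpace 𝓘(ℝ, EQ) z.rep.1 × TangentSpace 𝓘(ℝ, EF) z.rep.2 :=
  Classical.epsilon fun s : TangentSpace 𝓘(ℝ, EQ) z.rep.1 × TangentSpace 𝓘(ℝ, EF) z.rep.2 =>
    φ.form z.rep.1 s.1 = 0 ∧ (tauD 𝔮 z.rep.1 z.rep.2 s.1 s.2 : EX × EF) = w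

/-- The component of `w` in the horizontal subbundle `τ_* (ker φ)` of `T (Q ×_H F)`. -/
def horPart (z : Assoc 𝔮 F) (w : TangentSpace 𝓘(ℝ, EX × EF) z) :
    TangentSpace 𝓘(ℝ, EX × EF) z :=
  (tauD 𝔮 z.rep.1 z.rep.2 (splitVec φ z w).1 0 : EX × EF)

/-- The component of `w` in the vertical subbundle `τ_* (TF)` of `T (Q ×_H F)`. -/
def verPart (z : Assoc 𝔮 F) (w : TangentSpace 𝓘(ℝ, EX × EF) z) :
    TangentSpace 𝓘(ℝ, EX × EF) z :=
  (tauD 𝔮 z.rep.1 z.rep.2 0 (splitVec φ z w).2 : EX × EF)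

/-- The component of bidegree `(0, 2)` (both arguments vertical) of a 2-form. -/
def comp02 {V : Type*} (σ : TwoForm (EX × EF) (Assoc 𝔮 F) V) :
    TwoForm (EX × EF) (Assoc 𝔮 F) V := fun z w₁ w₂ =>
  σ z (verPart φ z w₁) (verPart φ z w₂)

/-- The component of bidegree `(1, 1)` of a 2-form. -/
def comp11 {V : Type*} [Add V] (σ : TwoForm (EX × EF) (Assoc 𝔮 F) V) :
    TwoForm (EX × EF) (Assoc 𝔮 F) V := fun z w₁ w₂ =>
  σ z (horPart φ z w₁) (verPart φ z w₂) + σ z (verPart φ z w₁) (horPart φ z w₂)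

/-- The component of bidegree `(2, 0)` (both arguments horizontal) of a 2-form. -/
def comp20 {V : Type*} (σ : TwoForm (EX × EF) (Assoc 𝔮 F) V) :
    TwoForm (EX × EF) (Assoc 𝔮 F) V := fun z w₁ w₂ =>
  σ z (horPart φ z w₁) (horPart φ z w₂)

/-! A form on `X` with values in the bundle `Q ×_H Ω(F)` is given by an equivariant family `θ`
over `q : Q` whose values take tangent vectors of `Q` and then tangent vectors of `F`. The next
definitions are the identification of such forms with forms on `Q ×_H F`. -/

/-- `Ω⁰(X; 𝓔²) → Ω^{0,2}`. -/
def toForm02 {V : Type*}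
    (θ : ∀ (_ : Q) (f : F), TangentSpace 𝓘(ℝ, EF) f → TangentSpace 𝓘(ℝ, EF) f → V) :
    TwoForm (EX × EF) (Assoc 𝔮 F) V := fun z w₁ w₂ =>
  θ z.rep.1 z.rep.2 (splitVec φ z w₁).2 (splitVec φ z w₂).2

/-- `Ω¹(X; 𝓔¹) → Ω^{1,1}` for a family with the horizontal argument first (`dx ⊗ ω ↦ dx ∧ ω`). -/
def toForm11HV {V : Type*} [Sub V]
    (θ : ∀ (q : Q) (f : F), TangentSpace 𝓘(ℝ, EQ) q → TangentSpace 𝓘(ℝ, EF) f → V) :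
    TwoForm (EX × EF) (Assoc 𝔮 F) V := fun z w₁ w₂ =>
  θ z.rep.1 z.rep.2 (splitVec φ z w₁).1 (splitVec φ z w₂).2 -
    θ z.rep.1 z.rep.2 (splitVec φ z w₂).1 (splitVec φ z w₁).2

/-- The element of `Ω^{1,1}` given by a family with the vertical argument first
(`ω ⊗ dx ↦ ω ∧ dx`). -/
def toForm11VH {V : Type*} [Sub V]
    (θ : ∀ (q : Q) (f : F), TangentSpace 𝓘(ℝ, EF) f → TangentSpace 𝓘(ℝ, EQ) q → V) :
    TwoForm (EX × EF) (Assoc 𝔮 F) V := fun z w₁ w₂ =>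
  θ z.rep.1 z.rep.2 (splitVec φ z w₁).2 (splitVec φ z w₂).1 -
    θ z.rep.1 z.rep.2 (splitVec φ z w₂).2 (splitVec φ z w₁).1

/-- `Ω²(X; 𝓔⁰) → Ω^{2,0}`. -/
def toForm20 {V : Type*}
    (θ : ∀ (q : Q) (_ : F), TangentSpace 𝓘(ℝ, EQ) q → TangentSpace 𝓘(ℝ, EQ) q → V) :
    TwoForm (EX × EF) (Assoc 𝔮 F) V := fun z w₁ w₂ =>
  θ z.rep.1 z.rep.2 (splitVec φ z w₁).1 (splitVec φ z w₂).1

end Splitting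

section Covering

variable {EX EH EQ EM EG EP : Type*}
  [NormedAddCommGroup EX] [NormedSpace ℝ EX] [NormedAddCommGroup EH] [NormedSpace ℝ EH]
  [NormedAddCommGroup EQ] [NormedSpace ℝ EQ]
  [NormedAddCommGroup EM] [NormedSpace ℝ EM] [NormedAddCommGroup EG] [NormedSpace ℝ EG]
  [NormedAddCommGroup EP] [NormedSpace ℝ EP]
  {X H Q M G P : Type*} [TopologicalSpace X] [ChartedSpace EX X] [IsManifold 𝓘(ℝ, EX) ∞ X]
  [Group H] [TopologicalSpace H] [ChartedSpace EH H]
  [TopologicalSpace Q] [ChartedSpace EQ Q] [MulAction Hᵐᵒᵖ Q]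
  [TopologicalSpace M] [ChartedSpace EM M] [IsManifold 𝓘(ℝ, EM) ∞ M]
  [Group G] [TopologicalSpace G] [ChartedSpace EG G]
  [TopologicalSpace P] [ChartedSpace EP P] [IsManifold 𝓘(ℝ, EP) ∞ P] [MulAction Gᵐᵒᵖ P]
  [MulAction H M] [ContMDiffSMul 𝓘(ℝ, EH) 𝓘(ℝ, EM) ∞ H M]
  [MulAction H P] [ContMDiffSMul 𝓘(ℝ, EH) 𝓘(ℝ, EP) ∞ H P] [SMulCommClass H Gᵐᵒᵖ P]

/-- The bundle projection `ℙ → 𝕄` maps `τ_* (u, v)` to `τ_* (u, π_* v)`. In particular it maps the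
horizontal (vertical) subbundle of `Tℙ` onto that of `T𝕄`, so that the bidegree of a form on `𝕄`
with values in `ad ℙ` is the bidegree of the horizontal equivariant form on `ℙ` representing it. -/
lemma principal_proj_tauD (𝔮 : PrincipalBundle EX EH EQ X H Q)
    (𝔭 : PrincipalBundle EM EG EP M G P)
    (hlift : ∀ (h : H) (p : P), 𝔭.proj (h • p) = h • 𝔭.proj p) (q : Q) (p : P)
    (u : TangentSpace 𝓘(ℝ, EQ) q) (v : TangentSpace 𝓘(ℝ, EP) p) :
    mfderiv 𝓘(ℝ, EX × EP) 𝓘(ℝ, EX × EM) (Assoc.principal 𝔮 𝔭 hlift).proj (Assoc.mk q p)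
        (tauD 𝔮 q p u v) =
      tauD 𝔮 q (𝔭.proj p) u (mfderiv 𝓘(ℝ, EP) 𝓘(ℝ, EM) 𝔭.proj p v) := by
  have hp : MDifferentiable 𝓘(ℝ, EX × EP) 𝓘(ℝ, EX × EM) (Assoc.principal 𝔮 𝔭 hlift).proj :=
    (Assoc.principal 𝔮 𝔭 hlift).smooth_proj.mdifferentiable (by simp)
  have hπ : MDifferentiable 𝓘(ℝ, EP) 𝓘(ℝ, EM) 𝔭.proj := 𝔭.smooth_proj.mdifferentiable (by simp)
  have h1 : MDifferentiable 𝓘(ℝ, EQ) 𝓘(ℝ, EX × EP) (fun q' => Assoc.mk (𝔮 := 𝔮) q' p) :=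
    ((Assoc.contMDiff_mk (𝔮 := 𝔮) (F := P) (EF := EP)).comp
      (contMDiff_id.prodMk contMDiff_const)).mdifferentiable (by simp)
  have h2 : MDifferentiable 𝓘(ℝ, EP) 𝓘(ℝ, EX × EP) (fun p' => Assoc.mk (𝔮 := 𝔮) q p') :=
    ((Assoc.contMDiff_mk (𝔮 := 𝔮) (F := P) (EF := EP)).comp
      (contMDiff_const.prodMk contMDiff_id)).mdifferentiable (by simp)
  have h3 : MDifferentiable 𝓘(ℝ, EM) 𝓘(ℝ, EX × EM) (fun m => Assoc.mk (𝔮 := 𝔮) q m) :=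
    ((Assoc.contMDiff_mk (𝔮 := 𝔮) (F := M) (EF := EM)).comp
      (contMDiff_const.prodMk contMDiff_id)).mdifferentiable (by simp)
  have e1 := mfderiv_comp q (hp (Assoc.mk q p)) (h1 q)
  have e2 := mfderiv_comp p (hp (Assoc.mk q p)) (h2 p)
  have e3 := mfderiv_comp p (h3 (𝔭.proj p)) (hπ p)
  have e4 : (Assoc.principal 𝔮 𝔭 hlift).proj ∘ (fun p' => Assoc.mk (𝔮 := 𝔮) q p') =
    (fun m => Assoc.mk (𝔮 := 𝔮) q m) ∘ 𝔭.proj := rfl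
  rw [e4, e3] at e2
  refine (map_add _ _ _).trans ?_
  exact congrArg₂ (· + ·) (DFunLike.congr_fun e1 u).symm (DFunLike.congr_fun e2 v).symm

end Covering

/-! ### Families of connections along the fibres, and the terms of the curvature formulae -/

section Families

variable {EX EH EQ EM EG EP : Type*}
  [NormedAddCommGroup EX] [NormedSpace ℝ EX] [NormedAddCommGroup EH] [NormedSpace ℝ EH]
  [NormedAddCommGroup EQ] [NormedSpace ℝ EQ]
  [NormedAddCommGroup EM] [NormedSpace ℝ EM] [NormedAddCommGroup EG] [NormedSpace ℝ EG]
  [NormedAddCommGroup EP] [NormedSpace ℝ EP]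
  {X H Q M G P : Type*} [TopologicalSpace X] [ChartedSpace EX X]
  [Group H] [TopologicalSpace H] [ChartedSpace EH H]
  [TopologicalSpace Q] [ChartedSpace EQ Q] [MulAction Hᵐᵒᵖ Q]
  [TopologicalSpace M] [ChartedSpace EM M]
  [Group G] [TopologicalSpace G] [ChartedSpace EG G]
  [TopologicalSpace P] [ChartedSpace EP P] [MulAction Gᵐᵒᵖ P] [MulAction H P]

/-- A section of the bundle `𝔸 = Q ×_H 𝒜(P)` over `X` whose fibre at `x` is the space of
connections on `ℙ` restricted to `𝕄_x`: a smooth `H`-equivariant map `q ↦ a_q` from `Q` to the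
connections on `P`. Here `H` acts on connections by pullback along the inverse, so that
equivariance reads `a_{q h} = h^* a_q`. -/
structure FibreConnection (𝔮 : PrincipalBundle EX EH EQ X H Q)
    (𝔭 : PrincipalBundle EM EG EP M G P) where
  conn : Q → Connection 𝔭
  equivariant : ∀ (h : H) (q : Q) (p : P) (w : TangentSpace 𝓘(ℝ, EP) p),
    (conn (op h • q)).form p w =
      (conn q).form (h • p) (mfderiv 𝓘(ℝ, EP) 𝓘(ℝ, EP) (fun p' : P => h • p') p w)
  smooth : ∀ p₀ : P, ContMDiffOn (𝓘(ℝ, EQ).prod 𝓘(ℝ, EP)) 𝓘(ℝ, EP →L[ℝ] EG) ∞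
    (fun x : Q × EP => chartRep (conn x.1).form p₀ x.2)
    (Set.univ ×ˢ (extChartAt 𝓘(ℝ, EP) p₀).target)

/-- A 1-form on `X` with values in the bundle `𝓔⁰(ad P) = Q ×_H Ω⁰(M; ad P)`: a smooth horizontal
`H`-equivariant 1-form on `Q` with values in the `G`-equivariant functions `P → Lie G`. The value
at the point `p` of `P` of the function `b_q u` is `form p q u`. -/
structure FibreAdForm (𝔮 : PrincipalBundle EX EH EQ X H Q)
    (_ : PrincipalBundle EM EG EP M G P) where
  form : P → OneForm EQ Q EG
  horizontal : ∀ (p : P) (q : Q) (ξ : EH), form p q (fundRight (G := H) q ξ) = 0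
  equivariant_left : ∀ (h : H) (p : P) (q : Q) (u : TangentSpace 𝓘(ℝ, EQ) q),
    form p (op h • q) (mfderiv 𝓘(ℝ, EQ) 𝓘(ℝ, EQ) (fun q' : Q => op h • q') q u) =
      form (h • p) q u
  equivariant_right : ∀ (g : G) (p : P) (q : Q) (u : TangentSpace 𝓘(ℝ, EQ) q),
    form (op g • p) q u = adj g⁻¹ (form p q u)
  smooth : ∀ q₀ : Q, ContMDiffOn (𝓘(ℝ, EP).prod 𝓘(ℝ, EQ)) 𝓘(ℝ, EQ →L[ℝ] EG) ∞
    (fun x : P × EQ => chartRep (form x.1) q₀ x.2)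
    (Set.univ ×ˢ (extChartAt 𝓘(ℝ, EQ) q₀).target)

variable {𝔮 : PrincipalBundle EX EH EQ X H Q} {𝔭 : PrincipalBundle EM EG EP M G P}
  (φ : Connection 𝔮) (a : FibreConnection 𝔮 𝔭) (b : FibreAdForm 𝔮 𝔭)

/-- The form `â` on `ℙ`: equal to `a` on vertical vectors and zero on horizontal ones. -/
def hatConn [ContMDiffSMul 𝓘(ℝ, EH) 𝓘(ℝ, EP) ∞ H P] (z : Assoc 𝔮 P)
    (w : TangentSpace 𝓘(ℝ, EX × EP) z) : EG :=
  (a.conn z.rep.1).form z.rep.2 (splitVec φ z w).2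

/-- The form `b̂` on `ℙ`: equal to `b` on horizontal vectors and zero on vertical ones. -/
def hatForm [ContMDiffSMul 𝓘(ℝ, EH) 𝓘(ℝ, EP) ∞ H P] (z : Assoc 𝔮 P)
    (w : TangentSpace 𝓘(ℝ, EX × EP) z) : EG :=
  b.form z.rep.2 z.rep.1 (splitVec φ z w).1

/-- The fibrewise curvature `F_a`. -/
def fibreCurvature (q : Q) : TwoForm EP P EG := (a.conn q).curvature

/-- The covariant derivative `∇^φ a`: the derivative of the equivariant map `q ↦ a_q` along the
horizontal part of `u`, evaluated on the tangent vector `w` of `P`. -/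
def covDeriv (q : Q) (p : P) (u : TangentSpace 𝓘(ℝ, EQ) q) (w : TangentSpace 𝓘(ℝ, EP) p) : EG :=
  let α : Q → EP →L[ℝ] EG := fun q' => (a.conn q').form p
  let dα : EQ →L[ℝ] EP →L[ℝ] EG := mfderiv 𝓘(ℝ, EQ) 𝓘(ℝ, EP →L[ℝ] EG) α q
  dα (φ.hor q u) w

/-- The vertical covariant derivative `∇^a_w (b u) = d (b u) (w) + [a w, b u]`. -/
def vertCovDeriv (q : Q) (p : P) (w : TangentSpace 𝓘(ℝ, EP) p) (u : TangentSpace 𝓘(ℝ, EQ) q) :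
    EG :=
  let β : P → EG := fun p' => b.form p' q u
  let dβ : EP →L[ℝ] EG := mfderiv 𝓘(ℝ, EP) 𝓘(ℝ, EG) β p
  dβ w + lieBr G ((a.conn q).form p w) (b.form p q u)

/-- The contraction `ι_Φ a = a (K_Φ)` with the curvature `Φ` of `φ`. -/
def contraction (q : Q) (p : P) (u v : TangentSpace 𝓘(ℝ, EQ) q) : EG :=
  (a.conn q).form p (killing H p (φ.curvature q u v))

/-- The covariant exterior derivative `d_φ b`: the exterior derivative on `Q` of the equivariant
form `b`, evaluated on horizontal parts. -/
def covExtDeriv (q : Q) (p : P) (u v : TangentSpace 𝓘(ℝ, EQ) q) : EG :=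
  extDerivOne (b.form p) q (φ.hor q u) (φ.hor q v)

/-- The bracket `[b, b] (u, v) = [b u, b v]`, taken pointwise on `P`. -/
def bracketForm (q : Q) (p : P) (u v : TangentSpace 𝓘(ℝ, EQ) q) : EG :=
  lieBr G (b.form p q u) (b.form p q v)

end Families

end

/-!
The curvature of `A` is computed upstairs, on `Q × P`, by pulling `A` back along the projection
`τ : Q × P → Q ×_H P`. The pullback is known explicitly (`form_at_tauLin`):
`(τ^* A) (u, v) = a_q (v) - a_q (K_{φ u}) + b_q (u)` at `(q, p)`.
For a `φ`-horizontal vector `u` this is the definition of `â + b̂`, which is independent of the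
representative `(q, p)` because `a` and `b` are equivariant; the vertical part of `u` is moved to
`P` by means of the infinitesimal form of `τ (q · h, p) = τ (q, h • p)` (`tauLin_fund`).

The definition of `splitVec` picks the unique pair of a horizontal vector and a vector of the fibre
over a given tangent vector. Existence comes from the local sections of `τ`
(`tauLin_surjective`), uniqueness from the fact that the kernel of `π_*` consists of fundamental
vectors (`PrincipalBundle.exists_fund_eq`), on which `φ` is injective.

Since the exterior derivative commutes with pullbacks (`extDerivOne_tauLin`), `dA` on
`τ_* (u, v)` is given by derivatives of the above expression in charts of `Q` and `P`. In the
vertical directions only `a_q` is differentiated. In the direction of `Q` the derivative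
falls on `q ↦ a_q`, on `b`, and on the factor `φ` in `a_q (K_{φ u})`; for horizontal vectors the
last contribution is `- a_q (K_{dφ (u, v)}) = - a_q (K_{Φ (u, v)})`. For a horizontal vector the term
`a_q (K_{φ u})` vanishes identically along `{q} × P`, so that the mixed component only contains
`∇^φ a` and the derivative of `b`. Adding the brackets of the values of `A` gives the three
components.

Tangent spaces of manifolds modelled on `E` are definitionally equal to `E`, and the vectors and
linear maps below are typed in the model spaces (`modelDeriv`, `OneForm.at`, `tauLin`, `splitAt`):
the points at which they live, such as `[q · h, p]` and `[q, h • p]`, are often only propositionally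
equal.
-/

noncomputable section

/-! ### Differentials as maps of the model spaces -/

section ModelDeriv

variable {E E' E'' K K' K'' : Type*} [NormedAddCommGroup E] [NormedSpace ℝ E]
  [NormedAddCommGroup E'] [NormedSpace ℝ E'] [NormedAddCommGroup E''] [NormedSpace ℝ E'']
  [TopologicalSpace K] [TopologicalSpace K'] [TopologicalSpace K'']
  {I : ModelWithCorners ℝ E K} {I' : ModelWithCorners ℝ E' K'} {I'' : ModelWithCorners ℝ E'' K''}
  {N N' N'' : Type*} [TopologicalSpace N] [ChartedSpace K N] [TopologicalSpace N']
  [ChartedSpace K' N'] [TopologicalSpace N''] [ChartedSpace K'' N'']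

/-- The manifold derivative as a map of the model spaces, to which all tangent spaces are
definitionally equal. Its type does not depend on the points, so that differentials at points
which are only propositionally equal can be compared. -/
def modelDeriv (I : ModelWithCorners ℝ E K) (I' : ModelWithCorners ℝ E' K') (f : N → N') (x : N) :
    E →L[ℝ] E' :=
  mfderiv I I' f x

lemma modelDeriv_comp_apply {g : N' → N''} {f : N → N'} {x : N} {y : N'} (hy : f x = y)
    (hg : MDifferentiableAt I' I'' g y) (hf : MDifferentiableAt I I' f x) (v : E) :
    modelDeriv I I'' (g ∘ f) x v = modelDeriv I' I'' g y (modelDeriv I I' f x v) := by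
  subst hy
  exact congrArg (fun L : E →L[ℝ] E'' => L v) (mfderiv_comp x hg hf)

lemma modelDeriv_eq_fderiv (f : E → E') (x : E) :
    modelDeriv 𝓘(ℝ, E) 𝓘(ℝ, E') f x = fderiv ℝ f x :=
  mfderiv_eq_fderiv

lemma modelDeriv_id_apply (x : N) (v : E) : modelDeriv I I id x v = v :=
  congrArg (fun L : E →L[ℝ] E => L v) (mfderiv_id (I := I) (x := x))

lemma modelDeriv_congr {f g : N → N'} {x : N} (h : f =ᶠ[nhds x] g) :
    modelDeriv I I' f x = modelDeriv I I' g x :=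
  h.mfderiv_eq

lemma modelDeriv_prodMk_apply {f : N → N'} {g : N → N''} {x : N}
    (hf : MDifferentiableAt I I' f x) (hg : MDifferentiableAt I I'' g x) (v : E) :
    modelDeriv I (I'.prod I'') (fun x => (f x, g x)) x v =
      (modelDeriv I I' f x v, modelDeriv I I'' g x v) :=
  congrArg (fun L : E →L[ℝ] E' × E'' => L v) (hf.mfderiv_prod hg)

lemma modelDeriv_prod_apply {f : N × N' → N''} {x : N × N'}
    (hf : MDifferentiableAt (I.prod I') I'' f x) (v : E × E') :
    modelDeriv (I.prod I') I'' f x v = modelDeriv I I'' (fun y => f (y, x.2)) x.1 v.1 +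
      modelDeriv I' I'' (fun y => f (x.1, y)) x.2 v.2 :=
  mfderiv_prod_eq_add_apply hf

/-- The value of a 1-form at a point, as a linear map on the model space. -/
def OneForm.at {V : Type*} [NormedAddCommGroup V] [NormedSpace ℝ V] {N : Type*}
    [TopologicalSpace N] [ChartedSpace E N] (α : OneForm E N V) (x : N) : E →L[ℝ] V :=
  α x

end ModelDeriv

/-! ### The bracket of the Lie algebra -/

section LieBracket

variable {EG : Type*} [NormedAddCommGroup EG] [NormedSpace ℝ EG]
  {G : Type*} [Group G] [TopologicalSpace G] [ChartedSpace EG G]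

lemma lieBr_swap (ξ η : EG) : lieBr G ξ η = - lieBr G η ξ := by
  let ξ' : GroupLieAlgebra 𝓘(ℝ, EG) G := ξ
  let η' : GroupLieAlgebra 𝓘(ℝ, EG) G := η
  exact VectorField.mlieBracket_swap_apply (V := mulInvariantVectorField ξ')
    (W := mulInvariantVectorField η') (x := (1 : G))

lemma lieBr_zero_zero : lieBr G (0 : EG) 0 = 0 := by
  have h := lieBr_swap (G := G) (0 : EG) 0
  have h2 : (2 : ℝ) • lieBr G (0 : EG) 0 = 0 := by
    rw [two_smul]
    nth_rewrite 1 [h]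
    exact neg_add_cancel _
  exact (smul_eq_zero.1 h2).resolve_left two_ne_zero

end LieBracket

/-! ### Fundamental vector fields -/

section Fundamental

variable {EX EH EQ : Type*}
  [NormedAddCommGroup EX] [NormedSpace ℝ EX] [NormedAddCommGroup EH] [NormedSpace ℝ EH]
  [NormedAddCommGroup EQ] [NormedSpace ℝ EQ]
  {X H Q : Type*} [TopologicalSpace X] [ChartedSpace EX X]
  [Group H] [TopologicalSpace H] [ChartedSpace EH H]
  [TopologicalSpace Q] [ChartedSpace EQ Q] [MulAction Hᵐᵒᵖ Q]

/-- The map `ξ ↦ q · ξ` from the Lie algebra to the tangent space of the orbit through `q`. -/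
def fund (q : Q) : EH →L[ℝ] EQ :=
  modelDeriv 𝓘(ℝ, EH) 𝓘(ℝ, EQ) (fun h : H => op h • q) 1

namespace PrincipalBundle

lemma mdifferentiable_act (𝔮 : PrincipalBundle EX EH EQ X H Q) (h : H) :
    MDifferentiable 𝓘(ℝ, EQ) 𝓘(ℝ, EQ) (fun q : Q => op h • q) :=
  (𝔮.smooth_act.comp (contMDiff_id.prodMk contMDiff_const)).mdifferentiable (by simp)

lemma mdifferentiable_orbit (𝔮 : PrincipalBundle EX EH EQ X H Q) (q : Q) :
    MDifferentiable 𝓘(ℝ, EH) 𝓘(ℝ, EQ) (fun h : H => op h • q) :=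
  (𝔮.smooth_act.comp (contMDiff_const.prodMk contMDiff_id)).mdifferentiable (by simp)

/-- The right translation by `h⁻¹` is inverse to that by `h`, on tangent vectors. -/
lemma modelDeriv_act_act_inv (𝔮 : PrincipalBundle EX EH EQ X H Q) (h : H) (q q' : Q)
    (hq : op h • q' = q) (u : EQ) :
    modelDeriv 𝓘(ℝ, EQ) 𝓘(ℝ, EQ) (fun x : Q => op h • x) q'
      (modelDeriv 𝓘(ℝ, EQ) 𝓘(ℝ, EQ) (fun x : Q => op h⁻¹ • x) q u) = u := by
  have e : (fun x : Q => op h • x) ∘ (fun x : Q => op h⁻¹ • x) = id := by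
    funext x
    simp [smul_smul]
  have hx : op h⁻¹ • q = q' := by simp [← hq, smul_smul]
  rw [← modelDeriv_comp_apply hx (𝔮.mdifferentiable_act h q') (𝔮.mdifferentiable_act h⁻¹ _), e,
    modelDeriv_id_apply]

variable [LieGroup 𝓘(ℝ, EH) ∞ H]

/-- A vector in the kernel of the differential of the bundle projection is tangent to the orbit:
in a local trivialization, `q' = s (π q') · c q'` with `c q = 1`, so that the derivative of the
identity at `q` is the sum of a term factoring through `π_*` and of the fundamental vector
field of `c_*`. -/
lemma exists_fund_eq (𝔮 : PrincipalBundle EX EH EQ X H Q) (q : Q) (u : EQ)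
    (hu : modelDeriv 𝓘(ℝ, EQ) 𝓘(ℝ, EX) 𝔮.proj q u = 0) :
    ∃ ξ : EH, u = fund (H := H) q ξ := by
  obtain ⟨t, ht⟩ := 𝔮.exists_triv (𝔮.proj q)
  set k := t.coord q
  have hnhds : 𝔮.proj ⁻¹' t.base ∈ nhds q :=
    (t.isOpen_base.preimage 𝔮.smooth_proj.continuous).mem_nhds ht
  -- The trivialization is normalized so that the section passes through `q`.
  let c : Q → H := fun q' => k⁻¹ * t.coord q'
  let s : X → Q := fun x => op k • t.sec x
  have hc : MDifferentiableAt 𝓘(ℝ, EQ) 𝓘(ℝ, EH) c q :=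
    (contMDiffAt_const.mul (t.smooth_coord.contMDiffAt hnhds)).mdifferentiableAt (by simp)
  have hs : MDifferentiableAt 𝓘(ℝ, EX) 𝓘(ℝ, EQ) s (𝔮.proj q) :=
    (𝔮.mdifferentiable_act k _).comp (𝔮.proj q)
      ((t.smooth_sec.contMDiffAt (t.isOpen_base.mem_nhds ht)).mdifferentiableAt (by simp))
  have hπ : MDifferentiableAt 𝓘(ℝ, EQ) 𝓘(ℝ, EX) 𝔮.proj q :=
    𝔮.smooth_proj.mdifferentiable (by simp) q
  have hsq : s (𝔮.proj q) = q := t.sec_act_coord q ht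
  have hcq : c q = 1 := inv_mul_cancel _
  let act : Q × H → Q := fun x => op x.2 • x.1
  let σ : Q → Q × H := fun q' => (s (𝔮.proj q'), c q')
  have hact : MDifferentiable (𝓘(ℝ, EQ).prod 𝓘(ℝ, EH)) 𝓘(ℝ, EQ) act :=
    𝔮.smooth_act.mdifferentiable (by simp)
  have hsπ : MDifferentiableAt 𝓘(ℝ, EQ) 𝓘(ℝ, EQ) (s ∘ 𝔮.proj) q := hs.comp q hπ
  have hσ : MDifferentiableAt 𝓘(ℝ, EQ) (𝓘(ℝ, EQ).prod 𝓘(ℝ, EH)) σ q := hsπ.prodMk hc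
  have hσq : σ q = (q, 1) := Prod.ext hsq hcq
  have hid : act ∘ σ =ᶠ[nhds q] id := by
    filter_upwards [hnhds] with q' hq'
    change op (k⁻¹ * t.coord q') • op k • t.sec (𝔮.proj q') = q'
    rw [smul_smul, ← op_mul, mul_inv_cancel_left, t.sec_act_coord q' hq']
  refine ⟨modelDeriv 𝓘(ℝ, EQ) 𝓘(ℝ, EH) c q u, ?_⟩
  have h1 : modelDeriv 𝓘(ℝ, EQ) 𝓘(ℝ, EQ) (s ∘ 𝔮.proj) q u = 0 := by
    rw [modelDeriv_comp_apply rfl hs hπ, hu, map_zero]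
  have h2 : modelDeriv 𝓘(ℝ, EQ) (𝓘(ℝ, EQ).prod 𝓘(ℝ, EH)) σ q u =
      (0, modelDeriv 𝓘(ℝ, EQ) 𝓘(ℝ, EH) c q u) :=
    (modelDeriv_prodMk_apply hsπ hc u).trans (congrArg (·, _) h1)
  have h3 := modelDeriv_comp_apply hσq (hact (q, 1)) hσ u
  rw [modelDeriv_congr hid, modelDeriv_id_apply, h2, modelDeriv_prod_apply (hact _), map_zero,
    zero_add] at h3
  exact h3

end PrincipalBundle

namespace Connection

variable {𝔮 : PrincipalBundle EX EH EQ X H Q} (φ : Connection 𝔮)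

lemma at_fund (q : Q) (ξ : EH) : φ.form.at q (fund (H := H) q ξ) = ξ :=
  φ.form_fund q ξ

/-- The horizontal part of a vector of the model space, regarded as a tangent vector at `q`. -/
def horAt (q : Q) (u : EQ) : EQ := u - fund (H := H) q (φ.form.at q u)

lemma at_horAt (q : Q) (u : EQ) : φ.form.at q (φ.horAt q u) = 0 := by
  rw [horAt, map_sub, at_fund, sub_self]

lemma horAt_of_at_eq_zero {q : Q} {u : EQ} (hu : φ.form.at q u = 0) : φ.horAt q u = u := by
  rw [horAt, hu, map_zero, sub_zero]

lemma at_act (h : H) (q : Q) (u : EQ) :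
    φ.form.at (op h • q) (modelDeriv 𝓘(ℝ, EQ) 𝓘(ℝ, EQ) (fun q' : Q => op h • q') q u) =
      adj h⁻¹ (φ.form.at q u) :=
  φ.form_act h q u

end Connection

end Fundamental

/-! ### The differential of the projection `τ` -/

section TauD

variable {EX EH EQ EF : Type*}
  [NormedAddCommGroup EX] [NormedSpace ℝ EX] [NormedAddCommGroup EH] [NormedSpace ℝ EH]
  [NormedAddCommGroup EQ] [NormedSpace ℝ EQ] [NormedAddCommGroup EF] [NormedSpace ℝ EF]
  {X H Q F : Type*} [TopologicalSpace X] [ChartedSpace EX X]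
  [Group H] [TopologicalSpace H] [ChartedSpace EH H]
  [TopologicalSpace Q] [ChartedSpace EQ Q] [MulAction Hᵐᵒᵖ Q]
  [TopologicalSpace F] [ChartedSpace EF F] [MulAction H F]

lemma mdifferentiable_smul_const (EH EF : Type*) [NormedAddCommGroup EH] [NormedSpace ℝ EH]
    [NormedAddCommGroup EF] [NormedSpace ℝ EF] [ChartedSpace EH H] [ChartedSpace EF F]
    [ContMDiffSMul 𝓘(ℝ, EH) 𝓘(ℝ, EF) ∞ H F] (f : F) :
    MDifferentiable 𝓘(ℝ, EH) 𝓘(ℝ, EF) (fun h : H => h • f) :=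
  ((contMDiff_smul (I := 𝓘(ℝ, EH)) (I' := 𝓘(ℝ, EF)) (n := ∞) (G := H) (M := F)).comp
    (contMDiff_id.prodMk contMDiff_const)).mdifferentiable (by simp)

lemma mdifferentiable_const_smul (EH EF : Type*) [NormedAddCommGroup EH] [NormedSpace ℝ EH]
    [NormedAddCommGroup EF] [NormedSpace ℝ EF] [ChartedSpace EH H] [ChartedSpace EF F]
    [ContMDiffSMul 𝓘(ℝ, EH) 𝓘(ℝ, EF) ∞ H F] (h : H) :
    MDifferentiable 𝓘(ℝ, EF) 𝓘(ℝ, EF) (fun f : F => h • f) :=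
  ((contMDiff_smul (I := 𝓘(ℝ, EH)) (I' := 𝓘(ℝ, EF)) (n := ∞) (G := H) (M := F)).comp
    (contMDiff_const.prodMk contMDiff_id)).mdifferentiable (by simp)

/-- The infinitesimal left action `ξ ↦ d/dt (exp (t ξ) • f)` at `t = 0`, that is, `- K_ξ (f)`. -/
def infAct (H : Type*) [Group H] [TopologicalSpace H] [ChartedSpace EH H] [MulAction H F]
    (f : F) : EH →L[ℝ] EF :=
  modelDeriv 𝓘(ℝ, EH) 𝓘(ℝ, EF) (fun h : H => h • f) 1

variable [ContMDiffSMul 𝓘(ℝ, EH) 𝓘(ℝ, EF) ∞ H F]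

/-- The differential of `τ` as a linear map of the model spaces. -/
def tauLin (𝔮 : PrincipalBundle EX EH EQ X H Q) (q : Q) (f : F) : EQ × EF →L[ℝ] EX × EF :=
  (modelDeriv 𝓘(ℝ, EQ) 𝓘(ℝ, EX × EF) (fun q' => Assoc.mk (𝔮 := 𝔮) q' f) q).coprod
    (modelDeriv 𝓘(ℝ, EF) 𝓘(ℝ, EX × EF) (fun f' => Assoc.mk (𝔮 := 𝔮) q f') f)

lemma tauLin_apply (𝔮 : PrincipalBundle EX EH EQ X H Q) (q : Q) (f : F) (u : EQ) (v : EF) :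
    tauLin 𝔮 q f (u, v) =
      modelDeriv 𝓘(ℝ, EQ) 𝓘(ℝ, EX × EF) (fun q' => Assoc.mk (𝔮 := 𝔮) q' f) q u +
      modelDeriv 𝓘(ℝ, EF) 𝓘(ℝ, EX × EF) (fun f' => Assoc.mk (𝔮 := 𝔮) q f') f v :=
  rfl

variable [IsManifold 𝓘(ℝ, EX) ∞ X] [IsManifold 𝓘(ℝ, EF) ∞ F]
  (𝔮 : PrincipalBundle EX EH EQ X H Q) (φ : Connection 𝔮)

namespace Assoc

lemma mdifferentiable_mk : MDifferentiable (𝓘(ℝ, EQ).prod 𝓘(ℝ, EF)) 𝓘(ℝ, EX × EF)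
    (fun x : Q × F => mk (𝔮 := 𝔮) x.1 x.2) :=
  contMDiff_mk.mdifferentiable (by simp)

lemma mdifferentiable_mk_left (f : F) : MDifferentiable 𝓘(ℝ, EQ) 𝓘(ℝ, EX × EF)
    (fun q : Q => mk (𝔮 := 𝔮) q f) :=
  (contMDiff_mk.comp (contMDiff_id.prodMk contMDiff_const)).mdifferentiable (by simp)

lemma mdifferentiable_mk_right (q : Q) : MDifferentiable 𝓘(ℝ, EF) 𝓘(ℝ, EX × EF)
    (fun f : F => mk (𝔮 := 𝔮) q f) :=
  (contMDiff_mk.comp (contMDiff_const.prodMk contMDiff_id)).mdifferentiable (by simp)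

end Assoc

lemma tauLin_eq_modelDeriv (q : Q) (f : F) :
    tauLin 𝔮 q f = modelDeriv (𝓘(ℝ, EQ).prod 𝓘(ℝ, EF)) 𝓘(ℝ, EX × EF)
      (fun x : Q × F => Assoc.mk (𝔮 := 𝔮) x.1 x.2) (q, f) :=
  ContinuousLinearMap.ext fun v =>
    (modelDeriv_prod_apply (Assoc.mdifferentiable_mk 𝔮 (q, f)) v).symm

/-- The invariance `τ (q · h, f) = τ (q, h • f)` on tangent vectors. -/
lemma tauLin_act (h : H) (q : Q) (f : F) (u : EQ) (v : EF) :
    tauLin 𝔮 (op h • q) f (modelDeriv 𝓘(ℝ, EQ) 𝓘(ℝ, EQ) (fun q' : Q => op h • q') q u, v) =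
      tauLin 𝔮 q (h • f) (u, modelDeriv 𝓘(ℝ, EF) 𝓘(ℝ, EF) (fun f' : F => h • f') f v) := by
  have e1 : (fun q' => Assoc.mk (𝔮 := 𝔮) q' f) ∘ (fun q' : Q => op h • q') =
      fun q' => Assoc.mk (𝔮 := 𝔮) q' (h • f) := funext fun q' => Assoc.mk_act q' h f
  have e2 : (fun f' => Assoc.mk (𝔮 := 𝔮) (op h • q) f') =
      (fun f' => Assoc.mk (𝔮 := 𝔮) q f') ∘ (fun f' : F => h • f') :=
    funext fun f' => Assoc.mk_act q h f'
  rw [tauLin_apply, tauLin_apply, ← modelDeriv_comp_apply rfl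
    (Assoc.mdifferentiable_mk_left 𝔮 f _) (𝔮.mdifferentiable_act h q), e1, e2,
    modelDeriv_comp_apply rfl (Assoc.mdifferentiable_mk_right 𝔮 q _)
      (mdifferentiable_const_smul EH EF h f)]

/-- Since `τ (q · h, f) = τ (q, h • f)`, the map `τ_*` exchanges the infinitesimal actions. -/
lemma tauLin_fund (q : Q) (f : F) (ξ : EH) :
    tauLin 𝔮 q f (fund (H := H) q ξ, (0 : EF)) = tauLin 𝔮 q f ((0 : EQ), infAct (EF := EF) H f ξ) := by
  have e : (fun q' => Assoc.mk (𝔮 := 𝔮) q' f) ∘ (fun h : H => op h • q) =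
      (fun f' => Assoc.mk (𝔮 := 𝔮) q f') ∘ (fun h : H => h • f) :=
    funext fun h => Assoc.mk_act q h f
  have h1 := modelDeriv_comp_apply (x := (1 : H)) (y := q) (by simp)
    (Assoc.mdifferentiable_mk_left (EF := EF) 𝔮 f q) (𝔮.mdifferentiable_orbit q 1) ξ
  have h2 := modelDeriv_comp_apply (x := (1 : H)) (y := f) (by simp)
    (Assoc.mdifferentiable_mk_right 𝔮 q f) (mdifferentiable_smul_const EH EF f 1) ξ
  rw [tauLin_apply, tauLin_apply, map_zero, map_zero, add_zero, zero_add]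
  rw [e] at h1
  exact h1.symm.trans h2

lemma tauLin_eq_tauLin_horAt (q : Q) (f : F) (u : EQ) (v : EF) :
    tauLin 𝔮 q f (u, v) = tauLin 𝔮 q f (φ.horAt q u, v + infAct H f (φ.form.at q u)) := by
  have h1 : (u, v) = (φ.horAt q u, v) + (fund (H := H) q (φ.form.at q u), (0 : EF)) := by
    simp [Connection.horAt]
  have h2 : (φ.horAt q u, v + infAct H f (φ.form.at q u)) =
      (φ.horAt q u, v) + ((0 : EQ), infAct H f (φ.form.at q u)) := by simp
  rw [h1, h2, map_add, map_add, tauLin_fund]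

/-- `τ_*` is surjective, since `τ` has a smooth local section through every point of `Q × F`. -/
lemma tauLin_surjective (q : Q) (f : F) : ∀ w : EX × EF, ∃ s : EQ × EF, tauLin 𝔮 q f s = w := by
  intro w
  obtain ⟨t, ht⟩ := 𝔮.exists_triv (𝔮.proj q)
  set k := t.coord q
  have hnhds : Assoc.toBase ⁻¹' t.base ∈ nhds (Assoc.mk (𝔮 := 𝔮) q f) :=
    (t.isOpen_base.preimage Assoc.continuous_toBase).mem_nhds ht
  -- The section given by `t`, translated by `k` so as to pass through `(q, f)`.
  let σ : Assoc 𝔮 F → Q × F := fun z =>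
    (op k • t.sec (Assoc.toBase z), k⁻¹ • Assoc.fibreCoord t z)
  have hb : MDifferentiableAt 𝓘(ℝ, EX × EF) 𝓘(ℝ, EX) (Assoc.toBase (𝔮 := 𝔮) (F := F))
      (Assoc.mk q f) := (Assoc.contMDiff_toBase.mdifferentiable (by simp)) _
  have hfc : MDifferentiableAt 𝓘(ℝ, EX × EF) 𝓘(ℝ, EF) (Assoc.fibreCoord (𝔮 := 𝔮) (F := F) t)
      (Assoc.mk q f) :=
    ((Assoc.contMDiffOn_triv t).2.contMDiffAt hnhds).mdifferentiableAt (by simp)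
  have hs : MDifferentiableAt 𝓘(ℝ, EX) 𝓘(ℝ, EQ) t.sec (𝔮.proj q) :=
    (t.smooth_sec.contMDiffAt (t.isOpen_base.mem_nhds ht)).mdifferentiableAt (by simp)
  have hσ : MDifferentiableAt 𝓘(ℝ, EX × EF) (𝓘(ℝ, EQ).prod 𝓘(ℝ, EF)) σ (Assoc.mk q f) := by
    refine MDifferentiableAt.prodMk ?_ ?_
    · exact (𝔮.mdifferentiable_act k _).comp (Assoc.mk q f)
        (MDifferentiableAt.comp (Assoc.mk q f) (g := t.sec) hs hb)
    · exact (mdifferentiable_const_smul EH EF k⁻¹ _).comp (Assoc.mk q f) hfc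
  have hσq : σ (Assoc.mk q f) = (q, f) := by
    refine Prod.ext (t.sec_act_coord q ht) ?_
    change k⁻¹ • Assoc.fibreCoord t (Assoc.mk q f) = f
    rw [Assoc.fibreCoord_mk t q f ht, inv_smul_smul]
  have hid : (fun x : Q × F => Assoc.mk (𝔮 := 𝔮) x.1 x.2) ∘ σ =ᶠ[nhds (Assoc.mk q f)] id := by
    filter_upwards [hnhds] with z hz
    change Assoc.mk (op k • t.sec (Assoc.toBase z)) (k⁻¹ • Assoc.fibreCoord t z) = z
    rw [Assoc.mk_act, smul_inv_smul, Assoc.mk_sec_fibreCoord t z hz]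
  have h := modelDeriv_comp_apply hσq (Assoc.mdifferentiable_mk 𝔮 (q, f)) hσ w
  rw [modelDeriv_congr hid, modelDeriv_id_apply] at h
  exact ⟨_, (congrArg (fun L : EQ × EF →L[ℝ] EX × EF => L _)
    (tauLin_eq_modelDeriv 𝔮 q f)).trans h.symm⟩

/-- The pair of vectors of the model spaces given by `splitVec`. -/
def splitAt (z : Assoc 𝔮 F) (w : EX × EF) : EQ × EF := splitVec φ z w

/-- The pair defining `splitVec` exists. -/
lemma splitAt_spec (z : Assoc 𝔮 F) (w : EX × EF) :
    φ.form.at z.rep.1 (splitAt 𝔮 φ z w).1 = 0 ∧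
      tauLin 𝔮 z.rep.1 z.rep.2 (splitAt 𝔮 φ z w) = w := by
  obtain ⟨⟨u, v⟩, h⟩ := tauLin_surjective 𝔮 z.rep.1 z.rep.2 w
  exact Classical.epsilon_spec (p := fun s : EQ × EF =>
      φ.form.at z.rep.1 s.1 = 0 ∧ tauLin 𝔮 z.rep.1 z.rep.2 s = w)
    ⟨(φ.horAt z.rep.1 u, v + infAct H z.rep.2 (φ.form.at z.rep.1 u)), φ.at_horAt _ u,
      (tauLin_eq_tauLin_horAt 𝔮 φ _ _ u v).symm.trans h⟩

variable [LieGroup 𝓘(ℝ, EH) ∞ H]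

/-- `τ_*` is injective on pairs of a `φ`-horizontal vector and a vector of the fibre: the
projection to `X` determines the first one up to a vertical vector, and the inclusions of the
fibre are immersions because they have the fibre coordinates as left inverses. -/
lemma eq_zero_of_tauLin_eq_zero (q : Q) (f : F) (u : EQ) (v : EF) (hu : φ.form.at q u = 0)
    (h : tauLin 𝔮 q f (u, v) = 0) : u = 0 ∧ v = 0 := by
  have hρ : MDifferentiable 𝓘(ℝ, EX × EF) 𝓘(ℝ, EX) (Assoc.toBase (𝔮 := 𝔮) (F := F)) :=
    Assoc.contMDiff_toBase.mdifferentiable (by simp)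
  have h1 : modelDeriv 𝓘(ℝ, EQ) 𝓘(ℝ, EX) 𝔮.proj q u = 0 := by
    have e1 := modelDeriv_comp_apply (f := fun x : Q × F => Assoc.mk (𝔮 := 𝔮) x.1 x.2)
      (x := (q, f)) rfl (hρ (Assoc.mk q f)) (Assoc.mdifferentiable_mk 𝔮 (q, f)) (u, v)
    have e2 : modelDeriv (𝓘(ℝ, EQ).prod 𝓘(ℝ, EF)) 𝓘(ℝ, EX)
        (Assoc.toBase ∘ fun x : Q × F => Assoc.mk (𝔮 := 𝔮) x.1 x.2) (q, f) (u, v) =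
        modelDeriv 𝓘(ℝ, EQ) 𝓘(ℝ, EX) 𝔮.proj q u := by
      refine (modelDeriv_comp_apply (g := 𝔮.proj) (f := Prod.fst) (y := q) rfl
        (𝔮.smooth_proj.mdifferentiable (by simp) q) mdifferentiableAt_fst (u, v)).trans ?_
      exact congrArg (modelDeriv 𝓘(ℝ, EQ) 𝓘(ℝ, EX) 𝔮.proj q)
        (congrArg (fun L : EQ × EF →L[ℝ] EQ => L (u, v)) mfderiv_fst)
    rw [← tauLin_eq_modelDeriv, h, map_zero, e2] at e1
    exact e1
  obtain ⟨ξ, hξ⟩ := 𝔮.exists_fund_eq q u h1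
  have hu0 : u = 0 := by
    have h2 : ξ = 0 := by rw [← φ.at_fund q ξ, ← hξ, hu]
    rw [hξ, h2, map_zero]
  refine ⟨hu0, ?_⟩
  subst hu0
  obtain ⟨t, ht⟩ := 𝔮.exists_triv (𝔮.proj q)
  have hfc : MDifferentiableAt 𝓘(ℝ, EX × EF) 𝓘(ℝ, EF) (Assoc.fibreCoord (𝔮 := 𝔮) (F := F) t)
      (Assoc.mk q f) :=
    ((Assoc.contMDiffOn_triv t).2.contMDiffAt
      ((t.isOpen_base.preimage Assoc.continuous_toBase).mem_nhds ht)).mdifferentiableAt (by simp)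
  have e : (fun f' : F => (t.coord q)⁻¹ • f') ∘ Assoc.fibreCoord t ∘
      (fun f' : F => Assoc.mk (𝔮 := 𝔮) q f') = id := by
    funext f'
    change (t.coord q)⁻¹ • Assoc.fibreCoord t (Assoc.mk q f') = f'
    rw [Assoc.fibreCoord_mk t q f' ht, inv_smul_smul]
  rw [tauLin_apply, map_zero, zero_add] at h
  rw [← modelDeriv_id_apply (I := 𝓘(ℝ, EF)) f v, ← e,
    modelDeriv_comp_apply rfl (mdifferentiable_const_smul EH EF _ _)
      (hfc.comp f (Assoc.mdifferentiable_mk_right 𝔮 q f)),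
    modelDeriv_comp_apply rfl hfc (Assoc.mdifferentiable_mk_right 𝔮 q f), h, map_zero, map_zero]

/-- The pair defining `splitVec` is unique. -/
lemma splitAt_eq (z : Assoc 𝔮 F) (w : EX × EF) (s : EQ × EF) (hs : φ.form.at z.rep.1 s.1 = 0)
    (h : tauLin 𝔮 z.rep.1 z.rep.2 s = w) : splitAt 𝔮 φ z w = s := by
  obtain ⟨h1, h2⟩ := splitAt_spec 𝔮 φ z w
  have h3 := eq_zero_of_tauLin_eq_zero 𝔮 φ z.rep.1 z.rep.2 ((splitAt 𝔮 φ z w).1 - s.1)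
    ((splitAt 𝔮 φ z w).2 - s.2) (by rw [map_sub, h1, hs, sub_zero])
    ((map_sub (tauLin 𝔮 z.rep.1 z.rep.2) (splitAt 𝔮 φ z w) s).trans (by rw [h2, h, sub_self]))
  exact Prod.ext (sub_eq_zero.1 h3.1) (sub_eq_zero.1 h3.2)

end TauD

/-! ### The exterior derivative of a 1-form along a smooth map -/

section Pullback

variable {E E' V : Type*} [NormedAddCommGroup E] [NormedSpace ℝ E]
  [NormedAddCommGroup E'] [NormedSpace ℝ E'] [NormedAddCommGroup V] [NormedSpace ℝ V]

/-- Naturality of the exterior derivative of 1-forms on vector spaces. The terms with the second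
derivative of the map cancel by symmetry. -/
lemma fderiv_apply_sub_fderiv_apply_of_comp {α : E' → E' →L[ℝ] V} {g : E → E'} {x : E}
    (hα : DifferentiableAt ℝ α (g x)) (hg : ContDiffAt ℝ ∞ g x) (u w : E) :
    fderiv ℝ α (g x) (fderiv ℝ g x u) (fderiv ℝ g x w) -
        fderiv ℝ α (g x) (fderiv ℝ g x w) (fderiv ℝ g x u) =
      fderiv ℝ (fun y => α (g y) (fderiv ℝ g y w)) x u -
        fderiv ℝ (fun y => α (g y) (fderiv ℝ g y u)) x w := by
  have hg1 : DifferentiableAt ℝ g x := hg.differentiableAt (by simp)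
  have hg2 : DifferentiableAt ℝ (fderiv ℝ g) x :=
    (hg.fderiv_right (m := ∞) le_rfl).differentiableAt (by simp)
  have key : ∀ v v' : E, fderiv ℝ (fun y => α (g y) (fderiv ℝ g y v)) x v' =
      α (g x) (fderiv ℝ (fderiv ℝ g) x v' v) +
        fderiv ℝ α (g x) (fderiv ℝ g x v') (fderiv ℝ g x v) := by
    intro v v'
    have h1 : HasFDerivAt (fun y => fderiv ℝ g y v) ((fderiv ℝ (fderiv ℝ g) x).flip v) x :=
      hg2.hasFDerivAt.clm_apply (hasFDerivAt_const v x) |>.congr_fderiv (by ext; simp)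
    have h2 : HasFDerivAt (fun y => α (g y)) ((fderiv ℝ α (g x)).comp (fderiv ℝ g x)) x :=
      hα.hasFDerivAt.comp x hg1.hasFDerivAt
    rw [(h2.clm_apply h1).fderiv]
    simp
  have hsymm : fderiv ℝ (fderiv ℝ g) x u w = fderiv ℝ (fderiv ℝ g) x w u :=
    hg.isSymmSndFDerivAt (by
      rw [minSmoothness_of_isRCLikeNormedField]
      exact WithTop.coe_le_coe.2 (le_top : (2 : ℕ∞) ≤ ⊤)) u w
  rw [key, key, hsymm]
  abel

lemma differentiableAt_apply_fderiv {α : E' → E' →L[ℝ] V} {g : E → E'} {x : E}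
    (hα : DifferentiableAt ℝ α (g x)) (hg : ContDiffAt ℝ ∞ g x) (w : E) :
    DifferentiableAt ℝ (fun y => α (g y) (fderiv ℝ g y w)) x :=
  (hα.comp x (hg.differentiableAt (by simp))).clm_apply
    (((hg.fderiv_right (m := ∞) le_rfl).differentiableAt (by simp)).clm_apply
      (differentiableAt_const w))

lemma fderiv_apply_left {f : E × E' → V} {x : E} {y : E'} (hf : DifferentiableAt ℝ f (x, y))
    (u : E) : fderiv ℝ f (x, y) (u, 0) = fderiv ℝ (fun x' => f (x', y)) x u := by
  have h : HasFDerivAt (fun x' => f (x', y)) _ x :=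
    HasFDerivAt.comp x hf.hasFDerivAt (hasFDerivAt_prodMk_left x y)
  rw [h.fderiv]
  simp

lemma fderiv_apply_right {f : E × E' → V} {x : E} {y : E'} (hf : DifferentiableAt ℝ f (x, y))
    (w : E') : fderiv ℝ f (x, y) (0, w) = fderiv ℝ (fun y' => f (x, y')) y w := by
  have h : HasFDerivAt (fun y' => f (x, y')) _ y :=
    HasFDerivAt.comp y hf.hasFDerivAt (hasFDerivAt_prodMk_right x y)
  rw [h.fderiv]
  simp

end Pullback

/-! ### 1-forms and functions in charts -/

section Charts

variable {E V : Type*} [NormedAddCommGroup E] [NormedSpace ℝ E]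
  [NormedAddCommGroup V] [NormedSpace ℝ V]
  {N : Type*} [TopologicalSpace N] [ChartedSpace E N]

lemma chartRep_apply (α : OneForm E N V) (x : N) (y v : E) :
    chartRep α x y v = α.at ((extChartAt 𝓘(ℝ, E) x).symm y)
      (modelDeriv 𝓘(ℝ, E) 𝓘(ℝ, E) (extChartAt 𝓘(ℝ, E) x).symm y v) :=
  rfl

variable [IsManifold 𝓘(ℝ, E) ∞ N]

lemma mdifferentiableAt_extChartAt_symm_of_mem (x : N) {y : E}
    (hy : y ∈ (extChartAt 𝓘(ℝ, E) x).target) :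
    MDifferentiableAt 𝓘(ℝ, E) 𝓘(ℝ, E) (extChartAt 𝓘(ℝ, E) x).symm y :=
  (((contMDiffOn_extChartAt_symm (n := ∞) x).contMDiffAt
    ((isOpen_extChartAt_target x).mem_nhds hy))).mdifferentiableAt (by simp)

/-- The tangent space at `x` is identified with the model space by the chart at `x`, so that the
differential of this chart at `x` becomes the identity. -/
lemma modelDeriv_extChartAt_symm_self (x : N) (v : E) :
    modelDeriv 𝓘(ℝ, E) 𝓘(ℝ, E) (extChartAt 𝓘(ℝ, E) x).symm (extChartAt 𝓘(ℝ, E) x x) v = v := by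
  have h1 : MDifferentiableAt 𝓘(ℝ, E) 𝓘(ℝ, E) (extChartAt 𝓘(ℝ, E) x) x :=
    (contMDiffAt_extChartAt (n := ∞)).mdifferentiableAt (by simp)
  have h2 := mdifferentiableAt_extChartAt_symm_of_mem x (mem_extChartAt_target (I := 𝓘(ℝ, E)) x)
  have h3 : (extChartAt 𝓘(ℝ, E) x).symm ∘ extChartAt 𝓘(ℝ, E) x =ᶠ[nhds x] id := by
    filter_upwards [extChartAt_source_mem_nhds (I := 𝓘(ℝ, E)) x] with y hy
    exact (extChartAt 𝓘(ℝ, E) x).left_inv hy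
  have h4 := modelDeriv_comp_apply rfl h2 h1 v
  have h5 : modelDeriv 𝓘(ℝ, E) 𝓘(ℝ, E) (extChartAt 𝓘(ℝ, E) x) x v = v :=
    congrArg (fun L : E →L[ℝ] E => L v) mfderiv_extChartAt_self
  rw [modelDeriv_congr h3, modelDeriv_id_apply, h5] at h4
  exact h4.symm

lemma chartRep_self (α : OneForm E N V) (x : N) :
    chartRep α x (extChartAt 𝓘(ℝ, E) x x) = α.at x := by
  ext v
  rw [chartRep_apply, modelDeriv_extChartAt_symm_self, extChartAt_to_inv]

/-- The differential of a function in the chart at `x` is its differential at `x`. -/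
lemma hasFDerivAt_comp_extChartAt_symm {f : N → V} {x : N}
    (hf : MDifferentiableAt 𝓘(ℝ, E) 𝓘(ℝ, V) f x) :
    HasFDerivAt (fun y => f ((extChartAt 𝓘(ℝ, E) x).symm y))
      (modelDeriv 𝓘(ℝ, E) 𝓘(ℝ, V) f x) (extChartAt 𝓘(ℝ, E) x x) := by
  have h2 := mdifferentiableAt_extChartAt_symm_of_mem x (mem_extChartAt_target (I := 𝓘(ℝ, E)) x)
  have h3 : MDifferentiableAt 𝓘(ℝ, E) 𝓘(ℝ, V) (f ∘ (extChartAt 𝓘(ℝ, E) x).symm)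
      (extChartAt 𝓘(ℝ, E) x x) := by
    refine MDifferentiableAt.comp (g := f) _ ?_ h2
    rwa [extChartAt_to_inv]
  have h4 := (mdifferentiableAt_iff_differentiableAt.1 h3).hasFDerivAt
  refine HasFDerivAt.congr_fderiv (f := f ∘ (extChartAt 𝓘(ℝ, E) x).symm) h4 ?_
  ext v
  have h5 := modelDeriv_comp_apply (extChartAt_to_inv (I := 𝓘(ℝ, E)) x) hf h2 v
  rw [modelDeriv_extChartAt_symm_self] at h5
  rw [← h5, modelDeriv_eq_fderiv]

end Charts

/-! ### Product charts, and `τ` in charts -/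

section ProductCharts

variable {EX EH EQ EP : Type*}
  [NormedAddCommGroup EX] [NormedSpace ℝ EX]
  [NormedAddCommGroup EH] [NormedSpace ℝ EH]
  [NormedAddCommGroup EQ] [NormedSpace ℝ EQ]
  [NormedAddCommGroup EP] [NormedSpace ℝ EP]
  {X H Q P : Type*}
  [TopologicalSpace Q] [ChartedSpace EQ Q]
  [TopologicalSpace P] [ChartedSpace EP P]

/-- The inverse of the product of the charts of `Q` at `q` and of `P` at `p`. -/
def prodChartSymm (EQ EP : Type*) [NormedAddCommGroup EQ] [NormedSpace ℝ EQ]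
    [NormedAddCommGroup EP] [NormedSpace ℝ EP] [ChartedSpace EQ Q] [ChartedSpace EP P]
    (q : Q) (p : P) (x : EQ × EP) : Q × P :=
  ((extChartAt 𝓘(ℝ, EQ) q).symm x.1, (extChartAt 𝓘(ℝ, EP) p).symm x.2)

/-- The point of the model space corresponding to `(q, p)`. -/
def prodChart (EQ EP : Type*) [NormedAddCommGroup EQ] [NormedSpace ℝ EQ]
    [NormedAddCommGroup EP] [NormedSpace ℝ EP] [ChartedSpace EQ Q] [ChartedSpace EP P]
    (q : Q) (p : P) : EQ × EP :=
  (extChartAt 𝓘(ℝ, EQ) q q, extChartAt 𝓘(ℝ, EP) p p)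

lemma prodChartSymm_prodChart (q : Q) (p : P) :
    prodChartSymm EQ EP q p (prodChart EQ EP q p) = (q, p) :=
  Prod.ext (extChartAt_to_inv q) (extChartAt_to_inv p)

/-- The domain of `prodChartSymm`. -/
def prodChartTarget (EQ EP : Type*) [NormedAddCommGroup EQ] [NormedSpace ℝ EQ]
    [NormedAddCommGroup EP] [NormedSpace ℝ EP] [ChartedSpace EQ Q] [ChartedSpace EP P]
    (q : Q) (p : P) : Set (EQ × EP) :=
  (extChartAt 𝓘(ℝ, EQ) q).target ×ˢ (extChartAt 𝓘(ℝ, EP) p).target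

lemma isOpen_prodChartTarget (q : Q) (p : P) : IsOpen (prodChartTarget EQ EP q p) :=
  (isOpen_extChartAt_target q).prod (isOpen_extChartAt_target p)

lemma prodChart_mem (q : Q) (p : P) : prodChart EQ EP q p ∈ prodChartTarget EQ EP q p :=
  ⟨mem_extChartAt_target q, mem_extChartAt_target p⟩

section Smoothness

variable [IsManifold 𝓘(ℝ, EQ) ∞ Q] [IsManifold 𝓘(ℝ, EP) ∞ P]

lemma contMDiffOn_prodChartSymm (q : Q) (p : P) :
    ContMDiffOn 𝓘(ℝ, EQ × EP) (𝓘(ℝ, EQ).prod 𝓘(ℝ, EP)) ∞ (prodChartSymm EQ EP q p)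
      (prodChartTarget EQ EP q p) :=
  ((contMDiffOn_extChartAt_symm q).comp contDiff_fst.contMDiff.contMDiffOn fun _ hx => hx.1).prodMk
    ((contMDiffOn_extChartAt_symm p).comp contDiff_snd.contMDiff.contMDiffOn fun _ hx => hx.2)

lemma modelDeriv_prodChartSymm (q : Q) (p : P) {x : EQ × EP} (hx : x ∈ prodChartTarget EQ EP q p)
    (v : EQ × EP) :
    modelDeriv 𝓘(ℝ, EQ × EP) (𝓘(ℝ, EQ).prod 𝓘(ℝ, EP)) (prodChartSymm EQ EP q p) x v =
      (modelDeriv 𝓘(ℝ, EQ) 𝓘(ℝ, EQ) (extChartAt 𝓘(ℝ, EQ) q).symm x.1 v.1,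
        modelDeriv 𝓘(ℝ, EP) 𝓘(ℝ, EP) (extChartAt 𝓘(ℝ, EP) p).symm x.2 v.2) := by
  have hq := mdifferentiableAt_extChartAt_symm_of_mem q hx.1
  have hp := mdifferentiableAt_extChartAt_symm_of_mem p hx.2
  have h1 : MDifferentiableAt 𝓘(ℝ, EQ × EP) 𝓘(ℝ, EQ) Prod.fst x :=
    contDiff_fst.contMDiff.mdifferentiable (n := 1) one_ne_zero x
  have h2 : MDifferentiableAt 𝓘(ℝ, EQ × EP) 𝓘(ℝ, EP) Prod.snd x :=
    contDiff_snd.contMDiff.mdifferentiable (n := 1) one_ne_zero x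
  have e1 : modelDeriv 𝓘(ℝ, EQ × EP) 𝓘(ℝ, EQ) Prod.fst x v = v.1 := by
    rw [modelDeriv_eq_fderiv, fderiv_fst]; rfl
  have e2 : modelDeriv 𝓘(ℝ, EQ × EP) 𝓘(ℝ, EP) Prod.snd x v = v.2 := by
    rw [modelDeriv_eq_fderiv, fderiv_snd]; rfl
  have h3 := modelDeriv_prodMk_apply (MDifferentiableAt.comp x (f := Prod.fst) hq h1)
    (MDifferentiableAt.comp x (f := Prod.snd) hp h2) v
  rw [modelDeriv_comp_apply rfl hq h1, modelDeriv_comp_apply rfl hp h2, e1, e2] at h3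
  exact h3

end Smoothness

variable [TopologicalSpace X] [ChartedSpace EX X]
  [Group H] [TopologicalSpace H] [ChartedSpace EH H]
  [MulAction Hᵐᵒᵖ Q] [MulAction H P] [ContMDiffSMul 𝓘(ℝ, EH) 𝓘(ℝ, EP) ∞ H P]

/-- The projection `τ` in the charts at `q`, `p` and `[q, p]`. -/
def tauChart (𝔮 : PrincipalBundle EX EH EQ X H Q) (q : Q) (p : P) (x : EQ × EP) : EX × EP :=
  extChartAt 𝓘(ℝ, EX × EP) (Assoc.mk (𝔮 := 𝔮) q p)
    (Assoc.mk (prodChartSymm EQ EP q p x).1 (prodChartSymm EQ EP q p x).2)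

variable {𝔮 : PrincipalBundle EX EH EQ X H Q}

lemma tauChart_prodChart (q : Q) (p : P) :
    tauChart 𝔮 q p (prodChart EQ EP q p) =
      extChartAt 𝓘(ℝ, EX × EP) (Assoc.mk (𝔮 := 𝔮) q p) (Assoc.mk q p) := by
  rw [tauChart, prodChartSymm_prodChart]

variable {V : Type*} [NormedAddCommGroup V] [NormedSpace ℝ V]

lemma differentiableAt_chartRep_tauChart {α : OneForm (EX × EP) (Assoc 𝔮 P) V}
    (hα : SmoothOneForm α) (q : Q) (p : P) :
    DifferentiableAt ℝ (chartRep α (Assoc.mk q p)) (tauChart 𝔮 q p (prodChart EQ EP q p)) := by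
  rw [tauChart_prodChart]
  exact ((hα _).contDiffAt ((isOpen_extChartAt_target _).mem_nhds
    (mem_extChartAt_target _))).differentiableAt (by simp)

variable [IsManifold 𝓘(ℝ, EX) ∞ X] [IsManifold 𝓘(ℝ, EQ) ∞ Q] [IsManifold 𝓘(ℝ, EP) ∞ P]

lemma contDiffAt_tauChart (q : Q) (p : P) :
    ContDiffAt ℝ ∞ (tauChart (EP := EP) 𝔮 q p) (prodChart EQ EP q p) := by
  have h1 : ContMDiffAt 𝓘(ℝ, EQ × EP) (𝓘(ℝ, EQ).prod 𝓘(ℝ, EP)) ∞ (prodChartSymm EQ EP q p)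
      (prodChart EQ EP q p) :=
    (contMDiffOn_prodChartSymm q p).contMDiffAt
      ((isOpen_prodChartTarget q p).mem_nhds (prodChart_mem q p))
  have h2 := (Assoc.contMDiff_mk (𝔮 := 𝔮) (F := P) (EF := EP)).contMDiffAt.comp _ h1
  have h3 : ContMDiffAt 𝓘(ℝ, EX × EP) 𝓘(ℝ, EX × EP) ∞
      (extChartAt 𝓘(ℝ, EX × EP) (Assoc.mk (𝔮 := 𝔮) q p)) (Assoc.mk q p) :=
    contMDiffAt_extChartAt
  have h4 := ContMDiffAt.comp_of_eq (g := extChartAt 𝓘(ℝ, EX × EP) (Assoc.mk (𝔮 := 𝔮) q p))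
    h3 h2 (by simp only [Function.comp_apply, prodChartSymm_prodChart])
  exact contMDiffAt_iff_contDiffAt.1 h4

/-- Near the point corresponding to `(q, p)`, the local expression of `τ` is defined and its
derivative, read at the corresponding point of `Q ×_H P`, is `τ_*`. -/
lemma eventually_fderiv_tauChart (𝔮 : PrincipalBundle EX EH EQ X H Q) (q : Q) (p : P) :
    ∀ᶠ x in nhds (prodChart EQ EP q p),
      (extChartAt 𝓘(ℝ, EX × EP) (Assoc.mk (𝔮 := 𝔮) q p)).symm (tauChart 𝔮 q p x) =
        Assoc.mk (prodChartSymm EQ EP q p x).1 (prodChartSymm EQ EP q p x).2 ∧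
      ∀ v : EQ × EP, modelDeriv 𝓘(ℝ, EX × EP) 𝓘(ℝ, EX × EP)
          (extChartAt 𝓘(ℝ, EX × EP) (Assoc.mk (𝔮 := 𝔮) q p)).symm (tauChart 𝔮 q p x)
          (fderiv ℝ (tauChart (EP := EP) 𝔮 q p) x v) =
        tauLin 𝔮 (prodChartSymm EQ EP q p x).1 (prodChartSymm EQ EP q p x).2
          (modelDeriv 𝓘(ℝ, EQ × EP) (𝓘(ℝ, EQ).prod 𝓘(ℝ, EP)) (prodChartSymm EQ EP q p) x v) := by
  set c := extChartAt 𝓘(ℝ, EX × EP) (Assoc.mk (𝔮 := 𝔮) q p)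
  let τ : Q × P → Assoc 𝔮 P := fun y => Assoc.mk y.1 y.2
  have hτ : MDifferentiable (𝓘(ℝ, EQ).prod 𝓘(ℝ, EP)) 𝓘(ℝ, EX × EP) τ := Assoc.mdifferentiable_mk 𝔮
  have hopen := isOpen_prodChartTarget (EQ := EQ) (EP := EP) q p
  have hsm := contMDiffOn_prodChartSymm (EQ := EQ) (EP := EP) q p
  have hcont : ContinuousAt (τ ∘ prodChartSymm EQ EP q p) (prodChart EQ EP q p) :=
    hτ.continuous.continuousAt.comp (hsm.continuousOn.continuousAt
      (hopen.mem_nhds (prodChart_mem q p)))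
  have hsrc : c.source ∈ nhds ((τ ∘ prodChartSymm EQ EP q p) (prodChart EQ EP q p)) := by
    rw [Function.comp_apply, prodChartSymm_prodChart]
    exact extChartAt_source_mem_nhds (I := 𝓘(ℝ, EX × EP)) (Assoc.mk (𝔮 := 𝔮) q p)
  have hdiff : ∀ᶠ x in nhds (prodChart EQ EP q p),
      DifferentiableAt ℝ (tauChart (EP := EP) 𝔮 q p) x :=
    (((contDiffAt_tauChart q p).of_le (m := 1) (WithTop.coe_le_coe.2 le_top)).eventually
      (by simp)).mono fun x hx => hx.differentiableAt (by simp)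
  filter_upwards [hdiff, hopen.mem_nhds (prodChart_mem q p),
    (hcont.eventually hsrc).eventually_nhds] with x hx hxt hxs
  have hxs' : τ (prodChartSymm EQ EP q p x) ∈ c.source := hxs.self_of_nhds
  have h1 : MDifferentiableAt 𝓘(ℝ, EQ × EP) (𝓘(ℝ, EQ).prod 𝓘(ℝ, EP)) (prodChartSymm EQ EP q p) x :=
    (hsm.contMDiffAt (hopen.mem_nhds hxt)).mdifferentiableAt (by simp)
  have h2 : c.symm ∘ tauChart 𝔮 q p =ᶠ[nhds x] τ ∘ prodChartSymm EQ EP q p :=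
    hxs.mono fun y hy => c.left_inv hy
  have h3 := mdifferentiableAt_extChartAt_symm_of_mem (Assoc.mk (𝔮 := 𝔮) q p) (c.map_source hxs')
  have h5 : c.symm (tauChart 𝔮 q p x) = τ (prodChartSymm EQ EP q p x) := c.left_inv hxs'
  refine ⟨h5, fun v => ?_⟩
  have h4 := modelDeriv_comp_apply (f := tauChart 𝔮 q p) rfl h3 hx.mdifferentiableAt v
  rw [modelDeriv_congr h2, modelDeriv_comp_apply rfl (hτ _) h1,
    modelDeriv_eq_fderiv] at h4
  rw [tauLin_eq_modelDeriv]
  exact h4.symm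

/-- The derivative of the local expression of `τ` at the point corresponding to `(q, p)`. -/
lemma fderiv_tauChart (q : Q) (p : P) (v : EQ × EP) :
    fderiv ℝ (tauChart 𝔮 q p) (prodChart EQ EP q p) v = tauLin 𝔮 q p v := by
  have h := (eventually_fderiv_tauChart (EP := EP) 𝔮 q p).self_of_nhds.2 v
  rw [modelDeriv_prodChartSymm q p (prodChart_mem q p), tauChart_prodChart,
    modelDeriv_extChartAt_symm_self, prodChartSymm_prodChart] at h
  rw [h]
  exact congrArg (tauLin 𝔮 q p) (Prod.ext (modelDeriv_extChartAt_symm_self q v.1)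
    (modelDeriv_extChartAt_symm_self p v.2))

/-- The pullback of a 1-form by `τ`, read in the charts at `q` and `p`. -/
def tauPullback (α : OneForm (EX × EP) (Assoc 𝔮 P) V) (q : Q) (p : P) (v x : EQ × EP) : V :=
  α.at (Assoc.mk (prodChartSymm EQ EP q p x).1 (prodChartSymm EQ EP q p x).2)
    (tauLin 𝔮 (prodChartSymm EQ EP q p x).1 (prodChartSymm EQ EP q p x).2
      (modelDeriv 𝓘(ℝ, EQ × EP) (𝓘(ℝ, EQ).prod 𝓘(ℝ, EP)) (prodChartSymm EQ EP q p) x v))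

lemma eventuallyEq_tauPullback (α : OneForm (EX × EP) (Assoc 𝔮 P) V) (q : Q) (p : P)
    (v : EQ × EP) :
    (fun x => chartRep α (Assoc.mk q p) (tauChart 𝔮 q p x)
      (fderiv ℝ (tauChart (EP := EP) 𝔮 q p) x v)) =ᶠ[nhds (prodChart EQ EP q p)]
      tauPullback α q p v := by
  filter_upwards [eventually_fderiv_tauChart (EP := EP) 𝔮 q p] with x hx
  rw [chartRep_apply, hx.1, hx.2, tauPullback]

lemma differentiableAt_tauPullback {α : OneForm (EX × EP) (Assoc 𝔮 P) V}
    (hα : SmoothOneForm α) (q : Q) (p : P) (v : EQ × EP) :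
    DifferentiableAt ℝ (tauPullback α q p v) (prodChart EQ EP q p) :=
  (differentiableAt_apply_fderiv (differentiableAt_chartRep_tauChart hα q p)
    (contDiffAt_tauChart q p) v).congr_of_eventuallyEq (eventuallyEq_tauPullback α q p v).symm

/-- The exterior derivative commutes with the pullback by `τ`. -/
lemma extDerivOne_tauLin {α : OneForm (EX × EP) (Assoc 𝔮 P) V}
    (hα : SmoothOneForm α) (q : Q) (p : P) (v w : EQ × EP) :
    extDerivOne α (Assoc.mk q p) (tauLin 𝔮 q p v) (tauLin 𝔮 q p w) =
      fderiv ℝ (tauPullback α q p w) (prodChart EQ EP q p) v -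
        fderiv ℝ (tauPullback α q p v) (prodChart EQ EP q p) w := by
  have h := fderiv_apply_sub_fderiv_apply_of_comp (differentiableAt_chartRep_tauChart hα q p)
    (contDiffAt_tauChart q p) v w
  rw [(eventuallyEq_tauPullback α q p w).fderiv_eq, (eventuallyEq_tauPullback α q p v).fderiv_eq,
    fderiv_tauChart, fderiv_tauChart, tauChart_prodChart] at h
  exact h

end ProductCharts

/-! ### The connection form in terms of `a` and `b` -/

section Total

variable {EX EH EQ EM EG EP : Type*}
  [NormedAddCommGroup EX] [NormedSpace ℝ EX]
  [NormedAddCommGroup EH] [NormedSpace ℝ EH]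
  [NormedAddCommGroup EQ] [NormedSpace ℝ EQ]
  [NormedAddCommGroup EM] [NormedSpace ℝ EM]
  [NormedAddCommGroup EG] [NormedSpace ℝ EG]
  [NormedAddCommGroup EP] [NormedSpace ℝ EP]
  {X H Q M G P : Type*}
  [TopologicalSpace X] [ChartedSpace EX X]
  [Group H] [TopologicalSpace H] [ChartedSpace EH H]
  [TopologicalSpace Q] [ChartedSpace EQ Q]
  [TopologicalSpace M] [ChartedSpace EM M]
  [Group G] [TopologicalSpace G] [ChartedSpace EG G]
  [TopologicalSpace P] [ChartedSpace EP P]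
  [MulAction Hᵐᵒᵖ Q] [MulAction Gᵐᵒᵖ P] [MulAction H P]
  {𝔮 : PrincipalBundle EX EH EQ X H Q} {φ : Connection 𝔮}
  {𝔭 : PrincipalBundle EM EG EP M G P}
  {a : FibreConnection 𝔮 𝔭} {b : FibreAdForm 𝔮 𝔭}

lemma FibreConnection.at_act (a : FibreConnection 𝔮 𝔭) (h : H) (q : Q) (p : P) (w : EP) :
    (a.conn (op h • q)).form.at p w =
      (a.conn q).form.at (h • p) (modelDeriv 𝓘(ℝ, EP) 𝓘(ℝ, EP) (fun p' : P => h • p') p w) :=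
  a.equivariant h q p w

lemma FibreAdForm.at_act (b : FibreAdForm 𝔮 𝔭) (h : H) (p : P) (q : Q) (u : EQ) :
    (b.form p).at (op h • q) (modelDeriv 𝓘(ℝ, EQ) 𝓘(ℝ, EQ) (fun q' : Q => op h • q') q u) =
      (b.form (h • p)).at q u :=
  b.equivariant_left h p q u

lemma FibreAdForm.at_horAt (b : FibreAdForm 𝔮 𝔭) (p : P) (q : Q) (u : EQ) :
    (b.form p).at q (φ.horAt q u) = (b.form p).at q u := by
  have h : (b.form p).at q (fund (H := H) q (φ.form.at q u)) = 0 := b.horizontal p q _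
  rw [Connection.horAt, map_sub, h, sub_zero]

lemma FibreConnection.differentiableAt_chartRep (a : FibreConnection 𝔮 𝔭) (q : Q) (p : P) :
    DifferentiableAt ℝ (chartRep (a.conn q).form p) (extChartAt 𝓘(ℝ, EP) p p) :=
  (((a.conn q).smooth p).contDiffAt ((isOpen_extChartAt_target p).mem_nhds
    (mem_extChartAt_target p))).differentiableAt (by simp)

lemma FibreAdForm.differentiableAt_chartRep (b : FibreAdForm 𝔮 𝔭) (p : P) (q : Q) :
    DifferentiableAt ℝ (chartRep (b.form p) q) (extChartAt 𝓘(ℝ, EQ) q q) := by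
  have h : ContMDiffOn 𝓘(ℝ, EQ) 𝓘(ℝ, EQ →L[ℝ] EG) ∞ (chartRep (b.form p) q)
      (extChartAt 𝓘(ℝ, EQ) q).target :=
    (b.smooth q).comp (f := fun y : EQ => (p, y))
      (contMDiff_const.prodMk contMDiff_id).contMDiffOn fun y hy => ⟨trivial, hy⟩
  exact (((contMDiffOn_iff_contDiffOn.1 h).contDiffAt ((isOpen_extChartAt_target q).mem_nhds
    (mem_extChartAt_target q)))).differentiableAt (by simp)

section Smoothness

variable [IsManifold 𝓘(ℝ, EP) ∞ P]

lemma FibreConnection.mdifferentiable_at (a : FibreConnection 𝔮 𝔭) (p : P) :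
    MDifferentiable 𝓘(ℝ, EQ) 𝓘(ℝ, EP →L[ℝ] EG) (fun q => (a.conn q).form.at p) := by
  have h : ContMDiff 𝓘(ℝ, EQ) 𝓘(ℝ, EP →L[ℝ] EG) ∞
      (fun q : Q => chartRep (a.conn q).form p (extChartAt 𝓘(ℝ, EP) p p)) :=
    (a.smooth p).comp_contMDiff (f := fun q : Q => (q, extChartAt 𝓘(ℝ, EP) p p))
      (contMDiff_id.prodMk contMDiff_const) fun q => ⟨trivial, mem_extChartAt_target p⟩
  simp only [chartRep_self] at h
  exact h.mdifferentiable (by simp)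

end Smoothness

section Smoothness

variable [IsManifold 𝓘(ℝ, EQ) ∞ Q]

lemma FibreAdForm.mdifferentiable_at (b : FibreAdForm 𝔮 𝔭) (q : Q) :
    MDifferentiable 𝓘(ℝ, EP) 𝓘(ℝ, EQ →L[ℝ] EG) (fun p => (b.form p).at q) := by
  have h : ContMDiff 𝓘(ℝ, EP) 𝓘(ℝ, EQ →L[ℝ] EG) ∞
      (fun p : P => chartRep (b.form p) q (extChartAt 𝓘(ℝ, EQ) q q)) :=
    (b.smooth q).comp_contMDiff (f := fun p : P => (p, extChartAt 𝓘(ℝ, EQ) q q))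
      (contMDiff_id.prodMk contMDiff_const) fun p => ⟨trivial, mem_extChartAt_target q⟩
  simp only [chartRep_self] at h
  exact h.mdifferentiable (by simp)

end Smoothness

variable [IsManifold 𝓘(ℝ, EX) ∞ X] [LieGroup 𝓘(ℝ, EH) ∞ H] [IsManifold 𝓘(ℝ, EM) ∞ M]
  [IsManifold 𝓘(ℝ, EP) ∞ P] [MulAction H M] [ContMDiffSMul 𝓘(ℝ, EH) 𝓘(ℝ, EM) ∞ H M]
  [ContMDiffSMul 𝓘(ℝ, EH) 𝓘(ℝ, EP) ∞ H P] [SMulCommClass H Gᵐᵒᵖ P]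
  {hlift : ∀ (h : H) (p : P), 𝔭.proj (h • p) = h • 𝔭.proj p}
  {A : Connection (Assoc.principal 𝔮 𝔭 hlift)}

/-- The pullback of `A = â + b̂` along `τ` is `a_q (v) - a_q (K_{φ u}) + b (u)`. On horizontal `u`
this is the definition of `â` and `b̂`, transported from the chosen representative of the point
`[q, p]` by equivariance; a vertical `u` can be replaced by a vector tangent to `P`. -/
lemma form_at_tauLin
    (hA : ∀ (z : Assoc 𝔮 P) (w : TangentSpace 𝓘(ℝ, EX × EP) z),
      A.form z w = hatConn φ a z w + hatForm φ b z w) (q : Q) (p : P) (u : EQ) (v : EP) :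
    A.form.at (Assoc.mk q p) (tauLin 𝔮 q p (u, v)) =
      (a.conn q).form.at p (v + infAct H p (φ.form.at q u)) + (b.form p).at q u := by
  have hrep : ∀ (z : Assoc 𝔮 P) (s : EQ × EP), φ.form.at z.rep.1 s.1 = 0 →
      A.form.at z (tauLin 𝔮 z.rep.1 z.rep.2 s) =
        (a.conn z.rep.1).form.at z.rep.2 s.2 + (b.form z.rep.2).at z.rep.1 s.1 := by
    intro z s hs
    have h1 := splitAt_eq 𝔮 φ z _ s hs rfl
    refine (hA z (tauLin 𝔮 z.rep.1 z.rep.2 s)).trans ?_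
    change (a.conn z.rep.1).form.at z.rep.2 (splitAt (EF := EP) 𝔮 φ z _).2 +
      (b.form z.rep.2).at z.rep.1 (splitAt (EF := EP) 𝔮 φ z _).1 = _
    rw [h1]
  have hhor : ∀ (u : EQ) (v : EP), φ.form.at q u = 0 →
      A.form.at (Assoc.mk q p) (tauLin 𝔮 q p (u, v)) =
        (a.conn q).form.at p v + (b.form p).at q u := by
    intro u v hu
    have h1 := hrep (Assoc.mk q p)
    obtain ⟨h, hq, hp⟩ := Assoc.mk_eq_iff.1 (Assoc.mk_rep (Assoc.mk (𝔮 := 𝔮) q p))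
    -- The representative chosen for `[q, p]` is `(q₀, h • p)` with `q₀ · h = q`; the pair `(u, v)` at
    -- `(q, p)` corresponds to its image under `h⁻¹` on `Q` and `h` on `P`.
    generalize (Assoc.mk (𝔮 := 𝔮) q p) = z at *
    generalize z.rep = r at *
    obtain ⟨q₀, p₀⟩ := r
    obtain rfl : p₀ = h • p := hp
    have hq' : op h⁻¹ • q = q₀ := by simp [← hq, smul_smul]
    have h2 := h1 (modelDeriv 𝓘(ℝ, EQ) 𝓘(ℝ, EQ) (fun x : Q => op h⁻¹ • x) q u,
      modelDeriv 𝓘(ℝ, EP) 𝓘(ℝ, EP) (fun p' : P => h • p') p v)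
      (by
        have := φ.at_act h⁻¹ q u
        rw [hq', hu, map_zero] at this
        exact this)
    obtain rfl : op h • q₀ = q := hq
    rwa [← tauLin_act, ← a.at_act, ← b.at_act, 𝔮.modelDeriv_act_act_inv h _ q₀ rfl] at h2
  rw [tauLin_eq_tauLin_horAt 𝔮 φ, hhor _ _ (φ.at_horAt q u), b.at_horAt]

end Total

/-! ### The curvature on vectors `τ_* (u, v)` -/

section Curvature

variable {EX EH EQ EM EG EP : Type*}
  [NormedAddCommGroup EX] [NormedSpace ℝ EX]
  [NormedAddCommGroup EH] [NormedSpace ℝ EH]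
  [NormedAddCommGroup EQ] [NormedSpace ℝ EQ]
  [NormedAddCommGroup EM] [NormedSpace ℝ EM]
  [NormedAddCommGroup EG] [NormedSpace ℝ EG]
  [NormedAddCommGroup EP] [NormedSpace ℝ EP]
  {X H Q M G P : Type*}
  [TopologicalSpace X] [ChartedSpace EX X]
  [Group H] [TopologicalSpace H] [ChartedSpace EH H]
  [TopologicalSpace Q] [ChartedSpace EQ Q]
  [TopologicalSpace M] [ChartedSpace EM M]
  [Group G] [TopologicalSpace G] [ChartedSpace EG G]
  [TopologicalSpace P] [ChartedSpace EP P]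
  [MulAction Hᵐᵒᵖ Q] [MulAction Gᵐᵒᵖ P] [MulAction H P]
  {𝔮 : PrincipalBundle EX EH EQ X H Q} {φ : Connection 𝔮}
  {𝔭 : PrincipalBundle EM EG EP M G P}
  {a : FibreConnection 𝔮 𝔭} {b : FibreAdForm 𝔮 𝔭}

lemma Connection.curvature_apply (A : Connection 𝔭) (p : P) (v w : EP) :
    A.curvature p v w = extDerivOne A.form p v w + lieBr G (A.form.at p v) (A.form.at p w) :=
  rfl

lemma Connection.curvature_swap (A : Connection 𝔭) (p : P) (v w : EP) :
    A.curvature p v w = - A.curvature p w v := by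
  have h : extDerivOne A.form p v w = - extDerivOne A.form p w v := (neg_sub _ _).symm
  rw [A.curvature_apply, A.curvature_apply, lieBr_swap, h, neg_add]

lemma FibreAdForm.modelDeriv_at_apply [IsManifold 𝓘(ℝ, EQ) ∞ Q] (b : FibreAdForm 𝔮 𝔭)
    (q : Q) (p : P) (w : EP) (u : EQ) :
    modelDeriv 𝓘(ℝ, EP) 𝓘(ℝ, EG) (fun p' => (b.form p').at q u) p w =
      modelDeriv 𝓘(ℝ, EP) 𝓘(ℝ, EQ →L[ℝ] EG) (fun p' => (b.form p').at q) p w u := by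
  have h := modelDeriv_comp_apply (g := ContinuousLinearMap.apply ℝ EG u) rfl
    (ContinuousLinearMap.apply ℝ EG u).differentiableAt.mdifferentiableAt
    (b.mdifferentiable_at q p) w
  rw [modelDeriv_eq_fderiv, ContinuousLinearMap.fderiv] at h
  exact h

variable [IsManifold 𝓘(ℝ, EX) ∞ X] [LieGroup 𝓘(ℝ, EH) ∞ H] [IsManifold 𝓘(ℝ, EQ) ∞ Q]
  [IsManifold 𝓘(ℝ, EM) ∞ M] [IsManifold 𝓘(ℝ, EP) ∞ P]
  [MulAction H M] [ContMDiffSMul 𝓘(ℝ, EH) 𝓘(ℝ, EM) ∞ H M]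
  [ContMDiffSMul 𝓘(ℝ, EH) 𝓘(ℝ, EP) ∞ H P] [SMulCommClass H Gᵐᵒᵖ P]
  {hlift : ∀ (h : H) (p : P), 𝔭.proj (h • p) = h • 𝔭.proj p}
  {A : Connection (Assoc.principal 𝔮 𝔭 hlift)}

/-- The pullback of `A` by `τ` in charts, in terms of the local expressions of `a`, `φ`
and `b`. -/
lemma tauPullback_form
    (hA : ∀ (z : Assoc 𝔮 P) (w : TangentSpace 𝓘(ℝ, EX × EP) z),
      A.form z w = hatConn φ a z w + hatForm φ b z w) (q : Q) (p : P) {x : EQ × EP}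
    (hx : x ∈ prodChartTarget EQ EP q p) (v : EQ × EP) :
    tauPullback A.form q p v x =
      chartRep (a.conn ((extChartAt 𝓘(ℝ, EQ) q).symm x.1)).form p x.2 v.2 +
      (a.conn ((extChartAt 𝓘(ℝ, EQ) q).symm x.1)).form.at ((extChartAt 𝓘(ℝ, EP) p).symm x.2)
        (infAct H ((extChartAt 𝓘(ℝ, EP) p).symm x.2) (chartRep φ.form q x.1 v.1)) +
      chartRep (b.form ((extChartAt 𝓘(ℝ, EP) p).symm x.2)) q x.1 v.1 := by
  rw [tauPullback, modelDeriv_prodChartSymm q p hx, form_at_tauLin hA, map_add]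
  rfl

/-- The derivative along `Q` of the pullback of `A`. The base point in `P` is fixed, so that only
the value at this point of the infinitesimal action of `H` enters. -/
lemma fderiv_tauPullback_left
    (hA : ∀ (z : Assoc 𝔮 P) (w : TangentSpace 𝓘(ℝ, EX × EP) z),
      A.form z w = hatConn φ a z w + hatForm φ b z w) (q : Q) (p : P) (u : EQ) (v : EQ × EP) :
    fderiv ℝ (tauPullback A.form q p v) (prodChart EQ EP q p) (u, 0) =
      modelDeriv 𝓘(ℝ, EQ) 𝓘(ℝ, EP →L[ℝ] EG) (fun q' => (a.conn q').form.at p) q u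
        (v.2 + infAct H p (φ.form.at q v.1)) +
      (a.conn q).form.at p (infAct H p
        (fderiv ℝ (chartRep φ.form q) (extChartAt 𝓘(ℝ, EQ) q q) u v.1)) +
      fderiv ℝ (chartRep (b.form p) q) (extChartAt 𝓘(ℝ, EQ) q q) u v.1 := by
  have h0 : (fun x => tauPullback A.form q p v (x, extChartAt 𝓘(ℝ, EP) p p))
      =ᶠ[nhds (extChartAt 𝓘(ℝ, EQ) q q)] fun x =>
        (a.conn ((extChartAt 𝓘(ℝ, EQ) q).symm x)).form.at p
          (v.2 + infAct H p (chartRep φ.form q x v.1)) + chartRep (b.form p) q x v.1 := by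
    filter_upwards [(isOpen_extChartAt_target q).mem_nhds
      (mem_extChartAt_target (I := 𝓘(ℝ, EQ)) q)] with x hx
    rw [tauPullback_form hA q p ⟨hx, mem_extChartAt_target p⟩]
    simp only [chartRep_self, extChartAt_to_inv]
    rw [map_add]
  have ha := hasFDerivAt_comp_extChartAt_symm (a.mdifferentiable_at p q)
  have hφ : HasFDerivAt (chartRep φ.form q) _ (extChartAt 𝓘(ℝ, EQ) q q) :=
    (((φ.smooth q).contDiffAt ((isOpen_extChartAt_target q).mem_nhds
      (mem_extChartAt_target q))).differentiableAt (by simp)).hasFDerivAt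
  have hb := (b.differentiableAt_chartRep p q).hasFDerivAt
  have h1 := (ha.clm_apply (((infAct (EF := EP) H p).hasFDerivAt.comp _
    (hφ.clm_apply (hasFDerivAt_const v.1 _))).const_add v.2)).add
      (hb.clm_apply (hasFDerivAt_const v.1 _))
  rw [prodChart, fderiv_apply_left (differentiableAt_tauPullback A.smooth q p v), h0.fderiv_eq]
  refine (congrArg (fun L : EQ →L[ℝ] EG => L u) h1.fderiv).trans ?_
  simp only [extChartAt_to_inv, chartRep_self, add_apply,
    ContinuousLinearMap.comp_apply, ContinuousLinearMap.flip_apply,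
    zero_apply, map_zero, zero_add, Function.comp_apply]
  abel

/-- The derivative along `P` of the pullback of `A`. The term with the infinitesimal action of `H`
vanishes identically in this direction, since `φ` does not depend on the point of `P`. -/
lemma fderiv_tauPullback_right
    (hA : ∀ (z : Assoc 𝔮 P) (w : TangentSpace 𝓘(ℝ, EX × EP) z),
      A.form z w = hatConn φ a z w + hatForm φ b z w) (q : Q) (p : P) (w : EP) (v : EQ × EP)
    (hv : φ.form.at q v.1 = 0) :
    fderiv ℝ (tauPullback A.form q p v) (prodChart EQ EP q p) (0, w) =
      fderiv ℝ (chartRep (a.conn q).form p) (extChartAt 𝓘(ℝ, EP) p p) w v.2 +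
      modelDeriv 𝓘(ℝ, EP) 𝓘(ℝ, EQ →L[ℝ] EG) (fun p' => (b.form p').at q) p w v.1 := by
  have h0 : (fun y => tauPullback A.form q p v (extChartAt 𝓘(ℝ, EQ) q q, y))
      =ᶠ[nhds (extChartAt 𝓘(ℝ, EP) p p)] fun y => chartRep (a.conn q).form p y v.2 +
        (b.form ((extChartAt 𝓘(ℝ, EP) p).symm y)).at q v.1 := by
    filter_upwards [(isOpen_extChartAt_target p).mem_nhds
      (mem_extChartAt_target (I := 𝓘(ℝ, EP)) p)] with y hy
    rw [tauPullback_form hA q p ⟨mem_extChartAt_target q, hy⟩]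
    simp only [chartRep_self, extChartAt_to_inv, hv, map_zero, add_zero]
  have ha := (a.differentiableAt_chartRep q p).hasFDerivAt
  have hb := hasFDerivAt_comp_extChartAt_symm (b.mdifferentiable_at q p)
  have h1 := (ha.clm_apply (hasFDerivAt_const v.2 _)).add
    (hb.clm_apply (hasFDerivAt_const v.1 _))
  rw [prodChart, fderiv_apply_right (differentiableAt_tauPullback A.smooth q p v), h0.fderiv_eq]
  refine (congrArg (fun L : EP →L[ℝ] EG => L w) h1.fderiv).trans ?_
  simp

/-- Among vertical vectors only the differential of `a_q` along `P` and its bracket remain. -/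
lemma curvature_vertical_vertical
    (hA : ∀ (z : Assoc 𝔮 P) (w : TangentSpace 𝓘(ℝ, EX × EP) z),
      A.form z w = hatConn φ a z w + hatForm φ b z w) (q : Q) (p : P) (v w : EP) :
    A.curvature (Assoc.mk q p) (tauLin 𝔮 q p (0, v)) (tauLin 𝔮 q p (0, w)) =
      fibreCurvature a q p v w := by
  rw [A.curvature_apply, extDerivOne_tauLin A.smooth, form_at_tauLin hA, form_at_tauLin hA,
    fderiv_tauPullback_right hA _ _ _ _ (map_zero _),
    fderiv_tauPullback_right hA _ _ _ _ (map_zero _)]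
  simp only [map_zero, add_zero]
  rfl

/-- The minus sign in front of `∇^a b` comes from the order of the arguments, both in
`dA (U, W) = U (A W) - W (A U)` and in the bracket. -/
lemma curvature_horizontal_vertical
    (hA : ∀ (z : Assoc 𝔮 P) (w : TangentSpace 𝓘(ℝ, EX × EP) z),
      A.form z w = hatConn φ a z w + hatForm φ b z w) (q : Q) (p : P) (u : EQ) (w : EP)
    (hu : φ.form.at q u = 0) :
    A.curvature (Assoc.mk q p) (tauLin 𝔮 q p (u, 0)) (tauLin 𝔮 q p (0, w)) =
      covDeriv φ a q p u w - vertCovDeriv a b q p w u := by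
  have hcov : covDeriv φ a q p u w =
      modelDeriv 𝓘(ℝ, EQ) 𝓘(ℝ, EP →L[ℝ] EG) (fun q' => (a.conn q').form.at p) q
        (φ.horAt q u) w := rfl
  have hvert : vertCovDeriv a b q p w u =
      modelDeriv 𝓘(ℝ, EP) 𝓘(ℝ, EG) (fun p' => (b.form p').at q u) p w +
        lieBr G ((a.conn q).form.at p w) ((b.form p).at q u) := rfl
  rw [hcov, hvert, φ.horAt_of_at_eq_zero hu, b.modelDeriv_at_apply, A.curvature_apply,
    extDerivOne_tauLin A.smooth, form_at_tauLin hA, form_at_tauLin hA,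
    fderiv_tauPullback_left hA, fderiv_tauPullback_right hA _ _ _ _ hu, lieBr_swap]
  simp only [hu, map_zero, add_zero, zero_add]
  abel

/-- Since `φ` vanishes on `u` and `v`, its exterior derivative there is the curvature `Φ`, and the
term `a_q (K_φ)` of the pullback contributes `- a_q (K_Φ)`. -/
lemma curvature_horizontal_horizontal
    (hA : ∀ (z : Assoc 𝔮 P) (w : TangentSpace 𝓘(ℝ, EX × EP) z),
      A.form z w = hatConn φ a z w + hatForm φ b z w) (q : Q) (p : P) (u v : EQ)
    (hu : φ.form.at q u = 0) (hv : φ.form.at q v = 0) :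
    A.curvature (Assoc.mk q p) (tauLin 𝔮 q p (u, 0)) (tauLin 𝔮 q p (v, 0)) =
      - contraction φ a q p u v + covExtDeriv φ b q p u v + bracketForm b q p u v := by
  have hΦ : φ.curvature q u v =
      fderiv ℝ (chartRep φ.form q) (extChartAt 𝓘(ℝ, EQ) q q) u v -
        fderiv ℝ (chartRep φ.form q) (extChartAt 𝓘(ℝ, EQ) q q) v u := by
    have h : φ.curvature q u v = fderiv ℝ (chartRep φ.form q) (extChartAt 𝓘(ℝ, EQ) q q) u v -
        fderiv ℝ (chartRep φ.form q) (extChartAt 𝓘(ℝ, EQ) q q) v u +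
        lieBr H (φ.form.at q u) (φ.form.at q v) := rfl
    rw [h, hu, hv, lieBr_zero_zero, add_zero]
  have hcon : contraction φ a q p u v =
      (a.conn q).form.at p (- infAct (EF := EP) H p (φ.curvature q u v)) := rfl
  have hext : covExtDeriv φ b q p u v =
      fderiv ℝ (chartRep (b.form p) q) (extChartAt 𝓘(ℝ, EQ) q q) (φ.horAt q u) (φ.horAt q v) -
        fderiv ℝ (chartRep (b.form p) q) (extChartAt 𝓘(ℝ, EQ) q q) (φ.horAt q v) (φ.horAt q u) :=
    rfl
  have hbr : bracketForm b q p u v = lieBr G ((b.form p).at q u) ((b.form p).at q v) := rfl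
  rw [hcon, hΦ, hext, hbr, φ.horAt_of_at_eq_zero hu, φ.horAt_of_at_eq_zero hv, A.curvature_apply,
    extDerivOne_tauLin A.smooth, form_at_tauLin hA, form_at_tauLin hA,
    fderiv_tauPullback_left hA, fderiv_tauPullback_left hA]
  simp only [hu, hv, map_zero, add_zero, zero_add, map_sub, map_neg]
  abel

end Curvature

end
/-- The curvature of the connection `A = â + b̂` on the principal `G`-bundle
`ℙ = Q ×_H P → 𝕄 = Q ×_H M` has the components `F^{0,2} = F_a`, `F^{1,1} = ∇^φ a + ∇^a b` and
`F^{2,0} = - ι_Φ a + d_φ b + [b, b]`. -/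
theorem mainTheorem7
    {EX EH EQ EM EG EP : Type*}
    [NormedAddCommGroup EX] [NormedSpace ℝ EX] [FiniteDimensional ℝ EX]
    [NormedAddCommGroup EH] [NormedSpace ℝ EH] [FiniteDimensional ℝ EH]
    [NormedAddCommGroup EQ] [NormedSpace ℝ EQ] [FiniteDimensional ℝ EQ]
    [NormedAddCommGroup EM] [NormedSpace ℝ EM] [FiniteDimensional ℝ EM]
    [NormedAddCommGroup EG] [NormedSpace ℝ EG] [FiniteDimensional ℝ EG]
    [NormedAddCommGroup EP] [NormedSpace ℝ EP] [FiniteDimensional ℝ EP]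
    {X H Q M G P : Type*}
    [TopologicalSpace X] [ChartedSpace EX X] [IsManifold 𝓘(ℝ, EX) ∞ X]
    [Group H] [TopologicalSpace H] [ChartedSpace EH H] [LieGroup 𝓘(ℝ, EH) ∞ H]
    [TopologicalSpace Q] [ChartedSpace EQ Q] [IsManifold 𝓘(ℝ, EQ) ∞ Q]
    [TopologicalSpace M] [ChartedSpace EM M] [IsManifold 𝓘(ℝ, EM) ∞ M]
    [Group G] [TopologicalSpace G] [ChartedSpace EG G] [LieGroup 𝓘(ℝ, EG) ∞ G]
    [TopologicalSpace P] [ChartedSpace EP P] [IsManifold 𝓘(ℝ, EP) ∞ P]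
    [MulAction Hᵐᵒᵖ Q] [MulAction Gᵐᵒᵖ P]
    [MulAction H M] [ContMDiffSMul 𝓘(ℝ, EH) 𝓘(ℝ, EM) ∞ H M]
    [MulAction H P] [ContMDiffSMul 𝓘(ℝ, EH) 𝓘(ℝ, EP) ∞ H P] [SMulCommClass H Gᵐᵒᵖ P]
    (𝔮 : PrincipalBundle EX EH EQ X H Q) (φ : Connection 𝔮)
    (𝔭 : PrincipalBundle EM EG EP M G P)
    (hlift : ∀ (h : H) (p : P), 𝔭.proj (h • p) = h • 𝔭.proj p)
    (a : FibreConnection 𝔮 𝔭) (b : FibreAdForm 𝔮 𝔭)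
    (A : Connection (Assoc.principal 𝔮 𝔭 hlift))
    (hA : ∀ (z : Assoc 𝔮 P) (w : TangentSpace 𝓘(ℝ, EX × EP) z),
      A.form z w = hatConn φ a z w + hatForm φ b z w) :
    comp02 φ A.curvature = toForm02 φ (fibreCurvature a) ∧
    comp11 φ A.curvature = toForm11HV φ (covDeriv φ a) + toForm11VH φ (vertCovDeriv a b) ∧
    comp20 φ A.curvature =
      - toForm20 φ (contraction φ a) + toForm20 φ (covExtDeriv φ b) + toForm20 φ (bracketForm b) := by
  -- The three formulae hold at every `[q, p]`; here `(q, p)` is the representative used by `splitVec`.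
  have hrep : ∀ z : Assoc 𝔮 P, Assoc.mk z.rep.1 z.rep.2 = z := Assoc.mk_rep
  refine ⟨?_, ?_, ?_⟩
  · funext z w₁ w₂
    have h := curvature_vertical_vertical hA z.rep.1 z.rep.2 (splitAt 𝔮 φ z w₁).2
      (splitAt 𝔮 φ z w₂).2
    rw [hrep z] at h
    exact h
  · funext z w₁ w₂
    have h1 := curvature_horizontal_vertical hA z.rep.1 z.rep.2 _ (splitAt 𝔮 φ z w₂).2
      (splitAt_spec 𝔮 φ z w₁).1
    have h2 := curvature_horizontal_vertical hA z.rep.1 z.rep.2 _ (splitAt 𝔮 φ z w₁).2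
      (splitAt_spec 𝔮 φ z w₂).1
    rw [hrep z] at h1 h2
    have h3 := (A.curvature_swap z _ _).trans (congrArg Neg.neg h2)
    refine (congrArg₂ (· + ·) h1 h3).trans ?_
    simp only [Pi.add_apply, toForm11HV, toForm11VH, splitAt]
    abel
  · funext z w₁ w₂
    have h := curvature_horizontal_horizontal hA z.rep.1 z.rep.2 _ _ (splitAt_spec 𝔮 φ z w₁).1
      (splitAt_spec 𝔮 φ z w₂).1
    rw [hrep z] at h
    exact h
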